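/- **Setting.** Let $d,m,J\in\mathbb N$, $\mathcal I=\{(k,l)\in\{1,\dots,m\}^2:k<l\}$, let $x_0\in\mathbb R^d$, and let $\Phi:\mathbb R^d\times\mathbb R^m\times\mathbb R^{\mathcal I}\to\mathbb R^d$ and $f:\mathbb R^d\to\mathbb R$ be measurable. Let $\xi_j^i$, $V_j^{kl}$ ($1\le j\le J$, $1\le i\le m$, $(k,l)\in\mathcal I$) be mutually independent with $\mathbb P(\xi_j^i=\pm\sqrt3)=\frac16$, $\mathbb P(\xi_j^i=0)=\frac23$, $\mathbb P(V_j^{kl}=\pm1)=\frac12$, and set $X_0=x_0$, $X_j=\Phi(X_{j-1},\xi_j,V_j)$ for $j=1,\dots,J$. Let $\mathbb P_j$ be the distribution of $X_j$. Conditional expectations given $X_j=x$ are understood, for every $x\in\mathbb R^d$, as expectations for the scheme started in $x$ at step $j$. Put $H_0(x)=1$, $H_1(x)=x$, $H_2(x)=\frac{x^2-1}{\sqrt2}$ and, for $j\in\{1,\dots,J\}$, $y\in\{-\sqrt3,0,\sqrt3\}^m$, $z\in\{-1,1\}^{\mathcal I}$ and $(o,r)\in\{0,1,2\}^m\times\{0,1\}^{\mathcal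 I}$ with $(o,r)\neq(0,0)$, $$q_j(x)=\mathbb E[f(X_J)\mid X_j=x],\qquad h_{j,y,z}(x)=q_j(\Phi(x,y,z)),$$ $$a_{j,o,r}(x)=\mathbb E\Bigl[f(X_J)\prod_{i=1}^m H_{o_i}(\xi_j^i)\prod_{(k,l)\in\mathcal I}(V_j^{kl})^{r_{kl}}\Bigm|X_{j-1}=x\Bigr],$$ $$p_m(y)=\frac{4^{\#\{i:\,y_i=0\}}}{6^m\,2^{m(m-1)/2}},\qquad c_m=3^m2^{m(m-1)/2},$$ $$C_{m,o}=\sum_{y\in\{-\sqrt3,0,\sqrt3\}^m}c_m2^{m(m-1)/2}\Bigl[p_m(y)\prod_{i=1}^mH_{o_i}(y_i)\Bigr]^2 .$$ **Assumptions.** Let $K\ge1$ and $N\ge1$ be integers and let $\psi_1,\dots,\psi_K:\mathbb R^d\to\mathbb R$ be measurable. (A1) There is a constant $A>0$ with $\sup_{x\in\mathbb R^d}|h_{j,y,z}(x)|\le A$ for all $j,y,z$. (A2) There are constants $\kappa>0$ and $C_\kappa>0$ such that, for all $j,y,z$, $$\inf_{g\in\mathrm{span}(\psi_1,\dots,\psi_K)}\int_{\mathbb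 R^d}(h_{j,y,z}-g)^2\,d\mathbb P_{j-1}\le\frac{C_\kappa}{K^\kappa}.$$ (A3) Let $(X^{(n)},\xi^{(n)},V^{(n)})$, $n=1,\dots,N$, be independent copies of the path $X$ together with its noise (the training paths). For each $j,y,z$ let $\hat h_{j,y,z}=\alpha_1\psi_1+\dots+\alpha_K\psi_K$, where $\alpha\in\mathbb R^K$ is random and minimises over $\beta\in\mathbb R^K$ the sum $$\sum_{n:\ \xi_j^{(n)}=y,\ V_j^{(n)}=z}\Bigl(q_j(X_j^{(n)})-\sum_{k=1}^K\beta_k\psi_k(X_{j-1}^{(n)})\Bigr)^2,$$ and let $\tilde h_{j,y,z}=T_A\hat h_{j,y,z}$ be its truncation, where $T_At=t$ if $|t|\le A$ and $T_At=A\,\mathrm{sgn}\,t$ otherwise. Define the estimates $$\tilde a_{j,o,r}(x)=\sum_{y\in\{-\sqrt3,0,\sqrt3\}^m}\ \sum_{z\in\{-1,1\}^{\mathcal I}}\Bigl[p_m(y)\prod_{i=1}^mH_{o_i}(y_i)\prod_{(k,l)\in\mathcal I}z_{kl}^{r_{kl}}\Bigr]\tilde h_{j,y,z}(x).$$ **Claim.**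 There is a universal constant $\tilde c>0$ (independent of all the objects above) such that, under (A1)–(A3), for all $j\in\{1,\dots,J\}$ and all $(o,r)\neq(0,0)$, $$\mathbb E\,\|\tilde a_{j,o,r}-a_{j,o,r}\|^2_{L^2(\mathbb P_{j-1})}\le c_m\tilde c\,A^2(\log N+1)\frac KN+\frac{8\,C_\kappa}{K^\kappa}\,C_{m,o},$$ where the expectation is over the training paths. -/

import Mathlib

open MeasureTheory ProbabilityTheory

namespace SRCV

noncomputable section

/-- The index set `{(k, l) : k < l}`. -/
abbrev Pairs (m : ℕ) : Type := {p : Fin m × Fin m // p.1 < p.2}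

/-- The finite set `{-√3, 0, √3}^m` of possible values of `ξ_j`. -/
def valuesXi (m : ℕ) : Finset (Fin m → ℝ) :=
  Fintype.piFinset fun _ => {-√3, 0, √3}

/-- The finite set `{-1, 1}^(pairs)` of possible values of `V_j`. -/
def valuesV (m : ℕ) : Finset (Pairs m → ℝ) :=
  Fintype.piFinset fun _ => {-1, 1}

/-- `H_0 = 1`, `H_1(x) = x`, `H_2(x) = (x² - 1) / √2`. -/
def hermite (n : Fin 3) (x : ℝ) : ℝ :=
  if n = 0 then 1 else if n = 1 then x else (x ^ 2 - 1) / √2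

/-- `∏_i H_{o_i}(y_i)`. -/
def hermiteProd {m : ℕ} (o : Fin m → Fin 3) (y : Fin m → ℝ) : ℝ :=
  ∏ i, hermite (o i) (y i)

/-- `∏_{k<l} z_{kl}^{r_{kl}}`. -/
def signProd {m : ℕ} (r : Pairs m → Fin 2) (z : Pairs m → ℝ) : ℝ :=
  ∏ p, z p ^ (r p : ℕ)

/-- The set of all `(o, r)` that do not vanish identically. -/
def indexU (m : ℕ) : Set ((Fin m → Fin 3) × (Pairs m → Fin 2)) :=
  {u | (∃ i, u.1 i ≠ 0) ∨ ∃ p, u.2 p ≠ 0}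

/-- `p_m(y) = 4^{#{i : y_i = 0}} / (6^m 2^{m(m-1)/2})`. -/
def prob {m : ℕ} (y : Fin m → ℝ) : ℝ :=
  (4 : ℝ) ^ (Finset.univ.filter fun i => y i = 0).card /
    ((6 : ℝ) ^ m * (2 : ℝ) ^ (m * (m - 1) / 2))

/-- `c_m = 3^m 2^{m(m-1)/2}`, the number of possible values of `(ξ_j, V_j)`. -/
def cConst (m : ℕ) : ℝ := (3 : ℝ) ^ m * (2 : ℝ) ^ (m * (m - 1) / 2)

/-- `C_{m,o} = ∑_y c_m 2^{m(m-1)/2} [p_m(y) ∏_i H_{o_i}(y_i)]²`. -/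
def cConstO {m : ℕ} (o : Fin m → Fin 3) : ℝ :=
  ∑ y ∈ valuesXi m,
    cConst m * (2 : ℝ) ^ (m * (m - 1) / 2) * (prob y * hermiteProd o y) ^ 2

/-- Random vectors `ξ_j ∈ ℝ^m` and `V_j ∈ ℝ^(pairs)`; only `j = 1, …, J` matter. -/
structure Noise (Ω : Type*) (m : ℕ) where
  xi : ℕ → Ω → Fin m → ℝ
  V : ℕ → Ω → Pairs m → ℝ

/-- The distributional requirements on the noise of a weak scheme of order two with `J` steps:
all the coordinates of all the `ξ_j` and `V_j`, `j = 1, …, J`, are mutually independent, with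
`P(ξ_j^i = ±√3) = 1/6`, `P(ξ_j^i = 0) = 2/3`, `P(V_j^{kl} = ±1) = 1/2`. -/
structure Noise.IsOrderTwo {Ω : Type*} [MeasurableSpace Ω] {m : ℕ} (ν : Noise Ω m) (J : ℕ)
    (P : Measure Ω) : Prop where
  measurable_xi : ∀ j ∈ Finset.Icc 1 J, Measurable (ν.xi j)
  measurable_V : ∀ j ∈ Finset.Icc 1 J, Measurable (ν.V j)
  xi_pos : ∀ j ∈ Finset.Icc 1 J, ∀ i, P {ω | ν.xi j ω i = √3} = 1 / 6
  xi_neg : ∀ j ∈ Finset.Icc 1 J, ∀ i, P {ω | ν.xi j ω i = -√3} = 1 / 6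
  xi_zero : ∀ j ∈ Finset.Icc 1 J, ∀ i, P {ω | ν.xi j ω i = 0} = 2 / 3
  V_pos : ∀ j ∈ Finset.Icc 1 J, ∀ p, P {ω | ν.V j ω p = 1} = 1 / 2
  V_neg : ∀ j ∈ Finset.Icc 1 J, ∀ p, P {ω | ν.V j ω p = -1} = 1 / 2
  indep : iIndepFun
    (fun (c : Finset.Icc 1 J × (Fin m ⊕ Pairs m)) (ω : Ω) =>
      Sum.elim (ν.xi c.1 ω) (ν.V c.1 ω) c.2) P

/-- A discretisation scheme in `ℝ^d` driven by an `m`-dimensional noise, with `J` time steps,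
starting point `x₀`, one-step map `Φ = Φ_Δ` and payoff `f`. -/
structure Scheme (d m : ℕ) where
  J : ℕ
  x₀ : Fin d → ℝ
  Φ : (Fin d → ℝ) → (Fin m → ℝ) → (Pairs m → ℝ) → (Fin d → ℝ)
  f : (Fin d → ℝ) → ℝ
  measurable_Φ : Measurable
    fun u : (Fin d → ℝ) × (Fin m → ℝ) × (Pairs m → ℝ) => Φ u.1 u.2.1 u.2.2
  measurable_f : Measurable f

variable {Ω : Type*} {d m : ℕ}

/-- The position, `n` steps after time `s`, of the scheme that sits in `x` at time `s`. -/
def Scheme.chainFrom (S : Scheme d m) (ν : Noise Ω m) (ω : Ω) (s : ℕ) (x : Fin d → ℝ) :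
    ℕ → (Fin d → ℝ)
  | 0 => x
  | n + 1 => S.Φ (S.chainFrom ν ω s x n) (ν.xi (s + n + 1) ω) (ν.V (s + n + 1) ω)

/-- The scheme `X_{Δ, jΔ}`, started at time `0` in `x₀`. -/
def Scheme.path (S : Scheme d m) (ν : Noise Ω m) (j : ℕ) (ω : Ω) : Fin d → ℝ :=
  S.chainFrom ν ω 0 S.x₀ j

/-- The terminal position `X_{Δ, T}`, given that the scheme sits in `x` at time `s ≤ J`. -/
def Scheme.terminal (S : Scheme d m) (ν : Noise Ω m) (s : ℕ) (x : Fin d → ℝ) (ω : Ω) :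
    Fin d → ℝ :=
  S.chainFrom ν ω s x (S.J - s)

variable [MeasurableSpace Ω]

/-- The distribution `P_{Δ, j}` of `X_{Δ, jΔ}`. -/
def Scheme.law (S : Scheme d m) (ν : Noise Ω m) (P : Measure Ω) (j : ℕ) :
    Measure (Fin d → ℝ) :=
  P.map (S.path ν j)

/-- `q_j(x) = E[f(X_{Δ,T}) | X_{Δ,jΔ} = x]`. -/
def Scheme.q (S : Scheme d m) (ν : Noise Ω m) (P : Measure Ω) (j : ℕ) (x : Fin d → ℝ) : ℝ :=
  ∫ ω, S.f (S.terminal ν j x ω) ∂P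

/-- `h_{j,y,z}(x) = q_j(Φ_Δ(x, y, z))`. -/
def Scheme.h (S : Scheme d m) (ν : Noise Ω m) (P : Measure Ω) (j : ℕ)
    (y : Fin m → ℝ) (z : Pairs m → ℝ) (x : Fin d → ℝ) : ℝ :=
  S.q ν P j (S.Φ x y z)

/-- `a_{j,o,r}(x) =
E[f(X_{Δ,T}) ∏_i H_{o_i}(ξ_j^i) ∏_{k<l} (V_j^{kl})^{r_{kl}} | X_{Δ,(j-1)Δ} = x]`. -/
def Scheme.a (S : Scheme d m) (ν : Noise Ω m) (P : Measure Ω) (j : ℕ)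
    (o : Fin m → Fin 3) (r : Pairs m → Fin 2) (x : Fin d → ℝ) : ℝ :=
  ∫ ω, S.f (S.terminal ν (j - 1) x ω) * hermiteProd o (ν.xi j ω) * signProd r (ν.V j ω) ∂P

/-- Uniform boundedness of all the functions `h_{j,y,z}` by `A`. -/
def Scheme.Bounded (S : Scheme d m) (ν : Noise Ω m) (P : Measure Ω) (A : ℝ) : Prop :=
  ∀ j ∈ Finset.Icc 1 S.J, ∀ y ∈ valuesXi m, ∀ z ∈ valuesV m, ∀ x, |S.h ν P j y z x| ≤ A

/-- All the functions `h_{j,y,z}` are approximated by the span of `ψ_1, …, ψ_K` in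
`L²(P_{Δ,j-1})` with squared error at most `C / K^κ`. -/
def Scheme.WellApproximated (S : Scheme d m) (ν : Noise Ω m) (P : Measure Ω) {K : ℕ}
    (ψ : Fin K → (Fin d → ℝ) → ℝ) (C κ : ℝ) : Prop :=
  ∀ j ∈ Finset.Icc 1 S.J, ∀ y ∈ valuesXi m, ∀ z ∈ valuesV m,
    ⨅ g ∈ Submodule.span ℝ (Set.range ψ),
        ∫⁻ x, ENNReal.ofReal ((S.h ν P j y z x - g x) ^ 2) ∂(S.law ν P (j - 1))
      ≤ ENNReal.ofReal (C / (K : ℝ) ^ κ)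

/-- The noises of `N` independent training paths: each of them has the law of the noise of the
scheme, and they are independent of each other. -/
structure IsTraining {N : ℕ} (τ : Fin N → Noise Ω m) (J : ℕ) (P : Measure Ω) : Prop where
  isOrderTwo : ∀ n, (τ n).IsOrderTwo J P
  indep : iIndepFun
    (fun (n : Fin N) (ω : Ω) (j : Finset.Icc 1 J) => ((τ n).xi j ω, (τ n).V j ω)) P

open Classical in
/-- The training paths with `ξ_j = y` and `V_j = z`. -/
def stratum {N : ℕ} (τ : Fin N → Noise Ω m) (j : ℕ) (y : Fin m → ℝ) (z : Pairs m → ℝ)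
    (ω : Ω) : Finset (Fin N) :=
  Finset.univ.filter fun n => (τ n).xi j ω = y ∧ (τ n).V j ω = z

/-- The linear combination `α_1 ψ_1 + … + α_K ψ_K`. -/
def linComb {K : ℕ} (ψ : Fin K → (Fin d → ℝ) → ℝ) (α : Fin K → ℝ) (x : Fin d → ℝ) : ℝ :=
  ∑ k, α k * ψ k x

/-- The residual sum of squares, over the stratum of `(y, z)` among the training paths, of the
regression of `q_j(X_{Δ,jΔ})` on `ψ_1(X_{Δ,(j-1)Δ}), …, ψ_K(X_{Δ,(j-1)Δ})`. -/
def Scheme.residual (S : Scheme d m) (ν : Noise Ω m) (P : Measure Ω) {K N : ℕ}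
    (ψ : Fin K → (Fin d → ℝ) → ℝ) (τ : Fin N → Noise Ω m) (j : ℕ)
    (y : Fin m → ℝ) (z : Pairs m → ℝ) (ω : Ω) (β : Fin K → ℝ) : ℝ :=
  ∑ n ∈ stratum τ j y z ω,
    (S.q ν P j (S.path (τ n) j ω) - linComb ψ β (S.path (τ n) (j - 1) ω)) ^ 2

/-- `α j y z ω` are (measurable, but otherwise arbitrary) least squares coefficients of the
stratified regressions, for all `j`, `y` and `z`. -/
def Scheme.IsRegression (S : Scheme d m) (ν : Noise Ω m) (P : Measure Ω) {K N : ℕ}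
    (ψ : Fin K → (Fin d → ℝ) → ℝ) (τ : Fin N → Noise Ω m)
    (α : ℕ → (Fin m → ℝ) → (Pairs m → ℝ) → Ω → Fin K → ℝ) : Prop :=
  ∀ j ∈ Finset.Icc 1 S.J, ∀ y ∈ valuesXi m, ∀ z ∈ valuesV m,
    Measurable (α j y z) ∧
    ∀ᵐ ω ∂P, ∀ β : Fin K → ℝ,
      S.residual ν P ψ τ j y z ω (α j y z ω) ≤ S.residual ν P ψ τ j y z ω β

/-- The truncation `T_A`. -/
def truncate (A t : ℝ) : ℝ := if |t| ≤ A then t else A * Real.sign t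

/-- The estimate of `a_{j,o,r}`: the weighted sum of the truncated regression estimates
`T_A (α_1 ψ_1 + … + α_K ψ_K)` of `h_{j,y,z}`, with `α = α j y z ω`. -/
def aEstimate {K : ℕ} (A : ℝ) (ψ : Fin K → (Fin d → ℝ) → ℝ)
    (α : ℕ → (Fin m → ℝ) → (Pairs m → ℝ) → Ω → Fin K → ℝ) (j : ℕ)
    (o : Fin m → Fin 3) (r : Pairs m → Fin 2) (ω : Ω) (x : Fin d → ℝ) : ℝ :=
  ∑ y ∈ valuesXi m, ∑ z ∈ valuesV m,
    prob y * hermiteProd o y * signProd r z * truncate A (linComb ψ (α j y z ω) x)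

end

end SRCV

/-! On the stratum of `(y, z)` the response `q_j(X_j)` equals `h_{j,y,z}(X_{j-1})`, so each
regression is noiseless: a bounded deterministic function is fitted linearly. For such a problem an
exchangeability argument bounds the expected risk without covering numbers and without a logarithm.

Leave one point out of `n + 1` i.i.d. points and predict it from the others. If its leverage is at
most `1/2`, the squared prediction error is at most twice the increase of the minimal residual sum
of squares when the point is added back, and this increase is at most twice its squared residual in
the full fit (`loo_of_lowLeverage`). Otherwise truncation bounds the error by `4 A²`. The leverages
are the diagonal of a projection of rank at most `K`, so at most `2 K` points have high leverage
(`card_high_leverage_le`). Summation gives at most `4` times the residual sum of any competitor plus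
`8 A² K` (`sum_looBound_le`). Each point is equally likely to be the fresh one, so expectation and
division by `n + 1` bound the risk by `4 ‖h - g‖² + 8 A² K / (n + 1)`
(`lintegral_truncated_leastSquares_le`).

The random size of a stratum is avoided by replacing each path outside it by the data point `(0,
0)`, which changes no residual sum. The `N` points stay i.i.d., and risks under their law are
`p_m(y)` times risks under `P_{j-1}`. Division by `p_m(y)` puts this factor into the denominator of
the `K` term only (`lintegral_stratum_le`).

Finally `a_{j,o,r}` is the same weighted sum of the `h_{j,y,z}` as the estimate is of the
regressions (`Scheme.a_eq_sum`). Cauchy–Schwarz over the `c_m` strata then gives the claim: the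
approximation errors add up to `C_{m,o}`, while in the `K` terms one factor `p_m(y)` cancels and `∏
H_{o_i}(ξ^i)` has second moment one (`sum_weight_mul_error`). -/

namespace SRCV

/-! ### Linear least squares and leave-one-out predictions -/

section LeastSquares

variable {ι : Type*} [Fintype ι] {K : ℕ}

/-- The residual sum of squares of the coefficients `β` on the data `(φ_i, u_i)`. -/
noncomputable def rss (D : ι → (Fin K → ℝ) × ℝ) (β : Fin K → ℝ) : ℝ :=
  ∑ i, ((D i).2 - β ⬝ᵥ (D i).1) ^ 2

/-- The minimal residual sum of squares. -/
noncomputable def minRss (D : ι → (Fin K → ℝ) × ℝ) : ℝ := ⨅ β, rss D β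

/-- The linear map that sends coefficients to the vector of fitted values. -/
noncomputable def fittedMap (D : ι → (Fin K → ℝ) × ℝ) : (Fin K → ℝ) →ₗ[ℝ] EuclideanSpace ℝ ι where
  toFun β := WithLp.toLp 2 fun i => β ⬝ᵥ (D i).1
  map_add' a b := by ext i; simp [add_dotProduct]
  map_smul' a b := by ext i; simp [smul_dotProduct]

lemma rss_nonneg (D : ι → (Fin K → ℝ) × ℝ) (β : Fin K → ℝ) : 0 ≤ rss D β :=
  Finset.sum_nonneg fun _ _ => sq_nonneg _

lemma bddBelow_range_rss (D : ι → (Fin K → ℝ) × ℝ) : BddBelow (Set.range (rss D)) :=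
  ⟨0, by rintro _ ⟨β, rfl⟩; exact rss_nonneg D β⟩

lemma minRss_le (D : ι → (Fin K → ℝ) × ℝ) (β : Fin K → ℝ) : minRss D ≤ rss D β :=
  ciInf_le (bddBelow_range_rss D) β

lemma minRss_eq {D : ι → (Fin K → ℝ) × ℝ} {β : Fin K → ℝ} (h : ∀ γ, rss D β ≤ rss D γ) :
    minRss D = rss D β :=
  le_antisymm (minRss_le D β) (le_ciInf h)

/-- Project the responses orthogonally onto the space of fitted vectors. No rank condition on the
features is needed. -/
lemma exists_normal_equations (D : ι → (Fin K → ℝ) × ℝ) :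
    ∃ β : Fin K → ℝ, ∀ γ : Fin K → ℝ,
      ∑ i, ((D i).2 - β ⬝ᵥ (D i).1) * (γ ⬝ᵥ (D i).1) = 0 := by
  let u : EuclideanSpace ℝ ι := WithLp.toLp 2 fun i => (D i).2
  let M := LinearMap.range (fittedMap D)
  obtain ⟨β, hβ⟩ : M.starProjection u ∈ M := by
    rw [Submodule.starProjection_apply]; exact Submodule.coe_mem _
  refine ⟨β, fun γ => ?_⟩
  have h := Submodule.starProjection_inner_eq_zero (K := M) u (fittedMap D γ) ⟨γ, rfl⟩
  rw [← hβ, PiLp.inner_apply] at h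
  rw [← h]
  refine Finset.sum_congr rfl fun i _ => ?_
  simp [u, fittedMap, mul_comm]

lemma rss_eq_of_normal_equations {D : ι → (Fin K → ℝ) × ℝ} {β : Fin K → ℝ}
    (hβ : ∀ γ : Fin K → ℝ, ∑ i, ((D i).2 - β ⬝ᵥ (D i).1) * (γ ⬝ᵥ (D i).1) = 0)
    (γ : Fin K → ℝ) :
    rss D γ = rss D β + ∑ i, ((γ - β) ⬝ᵥ (D i).1) ^ 2 := by
  have h := hβ (γ - β)
  have : rss D γ = rss D β + ∑ i, ((γ - β) ⬝ᵥ (D i).1) ^ 2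
      - 2 * ∑ i, ((D i).2 - β ⬝ᵥ (D i).1) * ((γ - β) ⬝ᵥ (D i).1) := by
    simp only [rss, Finset.mul_sum, ← Finset.sum_add_distrib, ← Finset.sum_sub_distrib]
    refine Finset.sum_congr rfl fun i _ => ?_
    rw [sub_dotProduct]; ring
  rw [this, h]; ring

lemma rss_le_of_normal_equations {D : ι → (Fin K → ℝ) × ℝ} {β : Fin K → ℝ}
    (hβ : ∀ γ : Fin K → ℝ, ∑ i, ((D i).2 - β ⬝ᵥ (D i).1) * (γ ⬝ᵥ (D i).1) = 0)
    (γ : Fin K → ℝ) : rss D β ≤ rss D γ := by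
  rw [rss_eq_of_normal_equations hβ γ]
  exact le_add_of_nonneg_right (Finset.sum_nonneg fun _ _ => sq_nonneg _)

/-- By Pythagoras every minimiser has the same fitted values as the projection, so the choice among
non-unique coefficients does not matter on the data. -/
lemma normal_equations_of_forall_rss_le {D : ι → (Fin K → ℝ) × ℝ} {β : Fin K → ℝ}
    (hβ : ∀ γ, rss D β ≤ rss D γ) (γ : Fin K → ℝ) :
    ∑ i, ((D i).2 - β ⬝ᵥ (D i).1) * (γ ⬝ᵥ (D i).1) = 0 := by
  obtain ⟨v, hv⟩ := exists_normal_equations D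
  have h0 : ∑ i, ((β - v) ⬝ᵥ (D i).1) ^ 2 = 0 := by
    have h1 := rss_eq_of_normal_equations hv β
    have h2 := hβ v
    exact le_antisymm (by linarith) (Finset.sum_nonneg fun _ _ => sq_nonneg _)
  rw [Finset.sum_eq_zero_iff_of_nonneg fun _ _ => sq_nonneg _] at h0
  rw [← hv γ]
  refine Finset.sum_congr rfl fun i hi => ?_
  have := pow_eq_zero_iff (two_ne_zero) |>.mp (h0 i hi)
  rw [sub_dotProduct, sub_eq_zero] at this
  rw [this]

/-- The leverages sum up to at most `K`, so at most `2 K` data points have a leverage above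
`1 / 2`. -/
lemma card_high_leverage_le (D : ι → (Fin K → ℝ) × ℝ) (s : Finset ι)
    (hs : ∀ i ∈ s, ∃ β : Fin K → ℝ,
      ∑ j, (β ⬝ᵥ (D j).1) ^ 2 < 2 * (β ⬝ᵥ (D i).1) ^ 2) :
    (s.card : ℝ) ≤ 2 * K := by
  classical
  let M := LinearMap.range (fittedMap D)
  let b := stdOrthonormalBasis ℝ M
  -- Diagonal entries of the orthogonal projection onto the fitted vectors; their sum is its trace,
  -- the dimension of `M`.
  let lev : ι → ℝ := fun i => ∑ k, ((b k : EuclideanSpace ℝ ι) i) ^ 2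
  have hlev : ∑ i, lev i ≤ K := by
    have h1 : ∑ i, lev i = Module.finrank ℝ M := by
      rw [Finset.sum_comm]
      have : ∀ k, ∑ i, ((b k : EuclideanSpace ℝ ι) i) ^ 2 = 1 := fun k => by
        have := b.orthonormal.1 k
        rw [← Submodule.norm_coe, EuclideanSpace.norm_eq, Real.sqrt_eq_one] at this
        simpa using this
      simp [this]
    have h2 := LinearMap.finrank_range_le (fittedMap D)
    rw [Module.finrank_fin_fun] at h2
    rw [h1]; exact_mod_cast h2
  have hhalf : ∀ i ∈ s, (1 / 2 : ℝ) ≤ lev i := by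
    intro i hi
    obtain ⟨β, hβ⟩ := hs i hi
    let w : M := ⟨fittedMap D β, β, rfl⟩
    have hw : ∀ j, (w : EuclideanSpace ℝ ι) j = β ⬝ᵥ (D j).1 := fun j => rfl
    have hnorm : ∑ k, (inner ℝ (b k) w) ^ 2 = ∑ j, (β ⬝ᵥ (D j).1) ^ 2 := by
      have := b.sum_sq_norm_inner_right w
      rw [← Submodule.norm_coe, EuclideanSpace.norm_sq_eq] at this
      simpa [hw] using this
    have hexp : β ⬝ᵥ (D i).1 = ∑ k, inner ℝ (b k) w * (b k : EuclideanSpace ℝ ι) i := by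
      have := congrArg (fun v : M => (v : EuclideanSpace ℝ ι) i) (b.sum_repr' w)
      rw [← hw, ← this]
      simp
    -- Cauchy–Schwarz in the orthonormal basis: the squared `i`-th entry of a fitted vector is at
    -- most its squared norm times `lev i`.
    have hcs := Finset.sum_mul_sq_le_sq_mul_sq Finset.univ (fun k => inner ℝ (b k) w)
      (fun k => (b k : EuclideanSpace ℝ ι) i)
    rw [← hexp, hnorm] at hcs
    by_contra hlt
    push Not at hlt
    have hpos : 0 ≤ ∑ j, (β ⬝ᵥ (D j).1) ^ 2 := Finset.sum_nonneg fun _ _ => sq_nonneg _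
    have := mul_le_mul_of_nonneg_left hlt.le hpos
    change _ ≤ _ * lev i at hcs
    linarith
  have h1 : (s.card : ℝ) * (1 / 2) ≤ ∑ i ∈ s, lev i := by
    rw [← nsmul_eq_mul]; exact Finset.card_nsmul_le_sum _ _ _ hhalf
  have h2 : ∑ i ∈ s, lev i ≤ ∑ i, lev i :=
    Finset.sum_le_sum_of_subset_of_nonneg (Finset.subset_univ _)
      fun i _ _ => Finset.sum_nonneg fun _ _ => sq_nonneg _
  linarith

end LeastSquares

/-! ### Deterministic leave-one-out bounds -/

section LeaveOneOut

variable {K n : ℕ}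

/-- The data point `w` has leverage at most `1 / 2` when it is added to the data `D`. -/
def LowLeverage (w : (Fin K → ℝ) × ℝ) (D : Fin n → (Fin K → ℝ) × ℝ) : Prop :=
  ∀ β : Fin K → ℝ, (β ⬝ᵥ w.1) ^ 2 ≤ ∑ j, (β ⬝ᵥ (D j).1) ^ 2

open Classical in
/-- A bound for the squared truncated prediction error at `w` of a regression on `D`. -/
noncomputable def looBound (A : ℝ) (w : (Fin K → ℝ) × ℝ) (D : Fin n → (Fin K → ℝ) × ℝ) : ℝ :=
  if LowLeverage w D then 2 * (minRss (Fin.cons w D : Fin (n + 1) → _) - minRss D)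
  else 4 * A ^ 2

lemma rss_succAbove (D : Fin (n + 1) → (Fin K → ℝ) × ℝ) (i : Fin (n + 1)) (β : Fin K → ℝ) :
    rss D β = ((D i).2 - β ⬝ᵥ (D i).1) ^ 2 + rss (i.removeNth D) β :=
  Fin.sum_univ_succAbove _ i

lemma rss_cons_removeNth (D : Fin (n + 1) → (Fin K → ℝ) × ℝ) (i : Fin (n + 1)) :
    rss (Fin.cons (D i) (i.removeNth D) : Fin (n + 1) → _) = rss D := by
  funext β
  rw [rss_succAbove D i, rss_succAbove _ 0]
  rfl

/-- If `w` has low leverage, then adding it to the data increases the residual sum of squares by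
at least half of the squared prediction error, and by at most twice its squared residual. -/
lemma loo_of_lowLeverage {w : (Fin K → ℝ) × ℝ} {D : Fin n → (Fin K → ℝ) × ℝ}
    (hw : LowLeverage w D) {β v : Fin K → ℝ} (hβ : ∀ γ, rss D β ≤ rss D γ)
    (hv : ∀ γ, rss (Fin.cons w D : Fin (n + 1) → _) v ≤ rss (Fin.cons w D : Fin (n + 1) → _) γ) :
    (w.2 - β ⬝ᵥ w.1) ^ 2 ≤ 2 * (minRss (Fin.cons w D : Fin (n + 1) → _) - minRss D) ∧
      minRss (Fin.cons w D : Fin (n + 1) → _) - minRss D ≤ 2 * (w.2 - v ⬝ᵥ w.1) ^ 2 := by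
  have nβ := normal_equations_of_forall_rss_le hβ (β - v)
  have nv := normal_equations_of_forall_rss_le hv (β - v)
  rw [Fin.sum_univ_succ] at nv
  simp only [Fin.cons_zero, Fin.cons_succ] at nv
  have hrss := rss_eq_of_normal_equations (normal_equations_of_forall_rss_le hβ) v
  have hcons : rss (Fin.cons w D : Fin (n + 1) → _) v = (w.2 - v ⬝ᵥ w.1) ^ 2 + rss D v :=
    rss_succAbove _ 0 _
  have hQ : ∑ j, ((v - β) ⬝ᵥ (D j).1) ^ 2 = ∑ j, ((β - v) ⬝ᵥ (D j).1) ^ 2 :=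
    Finset.sum_congr rfl fun j _ => by rw [← neg_sub, neg_dotProduct, neg_sq]
  have hdiff : ∑ j, ((D j).2 - v ⬝ᵥ (D j).1) * ((β - v) ⬝ᵥ (D j).1) =
      ∑ j, ((D j).2 - β ⬝ᵥ (D j).1) * ((β - v) ⬝ᵥ (D j).1) + ∑ j, ((β - v) ⬝ᵥ (D j).1) ^ 2 := by
    rw [← Finset.sum_add_distrib]
    refine Finset.sum_congr rfl fun j _ => ?_
    rw [sub_dotProduct]; ring
  have hlow := hw (β - v)
  rw [minRss_eq hβ, minRss_eq hv, hcons, hrss, hQ]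
  rw [hdiff, nβ] at nv
  have hs : β ⬝ᵥ w.1 = v ⬝ᵥ w.1 + (β - v) ⬝ᵥ w.1 := by rw [sub_dotProduct]; ring
  rw [hs]
  set s := (β - v) ⬝ᵥ w.1
  set Q := ∑ j, ((β - v) ⬝ᵥ (D j).1) ^ 2
  set e := w.2 - v ⬝ᵥ w.1 with he
  -- Both normal equations are tested with `β - v`. The residual sum grows by `e² + Q = e² - e s`
  -- and the prediction error is `e - s`, so both claims follow from `s² ≤ e²`, which is where low
  -- leverage enters.
  have hQe : Q = -(e * s) := by linarith
  have hse : s ^ 2 ≤ e ^ 2 := by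
    have : s ^ 2 ≤ -(e * s) := hQe ▸ hlow
    nlinarith [sq_nonneg (e + s)]
  have : w.2 - (v ⬝ᵥ w.1 + s) = e - s := by rw [he]; ring
  rw [this]
  constructor <;> nlinarith

lemma exists_forall_rss_le {ι : Type*} [Fintype ι] (D : ι → (Fin K → ℝ) × ℝ) :
    ∃ β, ∀ γ, rss D β ≤ rss D γ :=
  let ⟨β, hβ⟩ := exists_normal_equations D
  ⟨β, rss_le_of_normal_equations hβ⟩

lemma looBound_nonneg (A : ℝ) (w : (Fin K → ℝ) × ℝ) (D : Fin n → (Fin K → ℝ) × ℝ) :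
    0 ≤ looBound A w D := by
  unfold looBound
  split_ifs with h
  · obtain ⟨β, hβ⟩ := exists_forall_rss_le D
    obtain ⟨v, hv⟩ := exists_forall_rss_le (Fin.cons w D : Fin (n + 1) → _)
    exact (sq_nonneg _).trans (loo_of_lowLeverage h hβ hv).1
  · positivity

lemma abs_truncate_le {A : ℝ} (hA : 0 ≤ A) (t : ℝ) : |truncate A t| ≤ A := by
  unfold truncate
  split_ifs with h
  · exact h
  · rcases lt_trichotomy t 0 with ht | ht | ht
    · simp [Real.sign_of_neg ht, abs_of_nonneg hA]
    · simp [ht, hA]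
    · simp [Real.sign_of_pos ht, abs_of_nonneg hA]

lemma sq_truncate_sub_le {A u : ℝ} (hu : |u| ≤ A) (t : ℝ) :
    (truncate A t - u) ^ 2 ≤ (u - t) ^ 2 := by
  unfold truncate
  have hu' := abs_le.mp hu
  split_ifs with h
  · exact le_of_eq (by ring)
  · rcases lt_or_ge t 0 with ht | ht
    · rw [abs_of_neg ht] at h
      rw [Real.sign_of_neg ht]
      nlinarith
    · rw [abs_of_nonneg ht] at h
      rw [Real.sign_of_pos (by linarith [abs_nonneg u])]
      nlinarith

lemma sq_truncate_sub_le_looBound {A : ℝ} {w : (Fin K → ℝ) × ℝ} (hA : |w.2| ≤ A)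
    {D : Fin n → (Fin K → ℝ) × ℝ} {β : Fin K → ℝ} (hβ : ∀ γ, rss D β ≤ rss D γ) :
    (truncate A (β ⬝ᵥ w.1) - w.2) ^ 2 ≤ looBound A w D := by
  unfold looBound
  split_ifs with h
  · obtain ⟨v, hv⟩ := exists_forall_rss_le (Fin.cons w D : Fin (n + 1) → _)
    exact (sq_truncate_sub_le hA _).trans (loo_of_lowLeverage h hβ hv).1
  · have h1 := abs_le.mp (abs_truncate_le ((abs_nonneg _).trans hA) (β ⬝ᵥ w.1))
    have h2 := abs_le.mp hA
    nlinarith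

/-- A low-leverage point costs at most `2 · 2` times its squared residual in the full fit; the at
most `2 K` others cost `4 A²` each. -/
lemma sum_looBound_le (A : ℝ) (D : Fin (n + 1) → (Fin K → ℝ) × ℝ) (β : Fin K → ℝ) :
    ∑ i, looBound A (D i) (i.removeNth D) ≤ 4 * rss D β + 8 * A ^ 2 * K := by
  classical
  obtain ⟨v, hv⟩ := exists_forall_rss_le D
  let s := Finset.univ.filter fun i => ¬ LowLeverage (D i) (i.removeNth D)
  have hterm : ∀ i, looBound A (D i) (i.removeNth D) ≤
      4 * ((D i).2 - v ⬝ᵥ (D i).1) ^ 2 + if i ∈ s then 4 * A ^ 2 else 0 := by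
    intro i
    unfold looBound
    by_cases h : LowLeverage (D i) (i.removeNth D)
    · obtain ⟨b, hb⟩ := exists_forall_rss_le (i.removeNth D)
      have := (loo_of_lowLeverage h hb (v := v) (by simpa [rss_cons_removeNth] using hv)).2
      simp only [h, if_true, s, Finset.mem_filter, not_true, and_false, if_false]
      linarith
    · simp only [h, if_false, s, Finset.mem_filter, Finset.mem_univ, not_false_eq_true,
        and_self, if_true]
      linarith [sq_nonneg ((D i).2 - v ⬝ᵥ (D i).1)]
  have hcard : (s.card : ℝ) ≤ 2 * K := by
    refine card_high_leverage_le D s fun i hi => ?_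
    have := (Finset.mem_filter.mp hi).2
    unfold LowLeverage at this
    push Not at this
    obtain ⟨b, hb⟩ := this
    refine ⟨b, ?_⟩
    rw [Fin.sum_univ_succAbove _ i]
    change _ + ∑ j, (b ⬝ᵥ (i.removeNth D j).1) ^ 2 < _
    linarith
  calc _ ≤ ∑ i, (4 * ((D i).2 - v ⬝ᵥ (D i).1) ^ 2 + if i ∈ s then 4 * A ^ 2 else 0) :=
        Finset.sum_le_sum fun i _ => hterm i
    _ = 4 * rss D v + s.card * (4 * A ^ 2) := by
        rw [Finset.sum_add_distrib, ← Finset.mul_sum, Finset.sum_ite_mem, Finset.univ_inter,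
          Finset.sum_const, nsmul_eq_mul, rss]
    _ ≤ _ := by nlinarith [hv β, sq_nonneg A]

end LeaveOneOut

/-! ### Truncated least squares regression with noiseless bounded responses -/

section Regression

variable {K n : ℕ}

@[fun_prop]
lemma continuous_dotProduct_const (β : Fin K → ℝ) : Continuous fun φ : Fin K → ℝ => β ⬝ᵥ φ := by
  unfold dotProduct; fun_prop

/-- An infimum of continuous functions is upper semicontinuous. Bounding through minimal values thus
avoids any measurable selection of minimisers. -/
lemma measurable_minRss : Measurable (minRss : (Fin n → (Fin K → ℝ) × ℝ) → ℝ) := by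
  refine UpperSemicontinuous.measurable
    (upperSemicontinuous_ciInf (f := fun β D => rss D β) bddBelow_range_rss fun β => ?_)
  refine Continuous.upperSemicontinuous ?_
  unfold rss
  fun_prop

lemma measurableSet_lowLeverage :
    MeasurableSet {q : ((Fin K → ℝ) × ℝ) × (Fin n → (Fin K → ℝ) × ℝ) | LowLeverage q.1 q.2} := by
  refine IsClosed.measurableSet ?_
  simp only [LowLeverage, Set.ofPred_forall]
  refine isClosed_iInter fun β => isClosed_le ?_ ?_ <;> fun_prop

lemma measurable_looBound (A : ℝ) :
    Measurable fun q : ((Fin K → ℝ) × ℝ) × (Fin n → (Fin K → ℝ) × ℝ) => looBound A q.1 q.2 := by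
  classical
  unfold looBound
  refine Measurable.ite measurableSet_lowLeverage ?_ measurable_const
  refine ((measurable_minRss.comp ?_).sub (measurable_minRss.comp measurable_snd)).const_mul 2
  refine measurable_pi_iff.mpr fun i => ?_
  refine Fin.cases ?_ (fun j => ?_) i
  · exact measurable_fst
  · exact (measurable_pi_apply j).comp measurable_snd

lemma lintegral_pi_removeNth {E : Type*} [MeasurableSpace E] (μ : Measure E)
    [IsProbabilityMeasure μ] {G : E × (Fin n → E) → ENNReal} (hG : Measurable G)
    (i : Fin (n + 1)) :
    ∫⁻ D : Fin (n + 1) → E, G (D i, i.removeNth D) ∂(Measure.pi fun _ => μ) =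
      ∫⁻ D, ∫⁻ w, G (w, D) ∂μ ∂(Measure.pi fun _ => μ) := by
  have h := (measurePreserving_piFinSuccAbove (fun _ : Fin (n + 1) => μ) i).lintegral_comp hG
  have h' : ∀ D : Fin (n + 1) → E,
      MeasurableEquiv.piFinSuccAbove (fun _ => E) i D = (D i, i.removeNth D) := fun _ => rfl
  simp only [h'] at h
  rw [h, lintegral_prod_symm _ hG.aemeasurable]

lemma sum_lintegral_removeNth {E : Type*} [MeasurableSpace E] (μ : Measure E)
    [IsProbabilityMeasure μ] {G : E × (Fin n → E) → ENNReal} (hG : Measurable G) :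
    ∫⁻ D : Fin (n + 1) → E, ∑ i, G (D i, i.removeNth D) ∂(Measure.pi fun _ => μ) =
      ((n + 1 : ℕ) : ENNReal) * ∫⁻ D, ∫⁻ w, G (w, D) ∂μ ∂(Measure.pi fun _ => μ) := by
  rw [lintegral_finsetSum, Finset.sum_congr rfl fun i _ => lintegral_pi_removeNth μ hG i,
    Finset.sum_const, Finset.card_univ, Fintype.card_fin, nsmul_eq_mul]
  exact fun i _ => hG.comp ((measurable_pi_apply i).prodMk
    (measurable_pi_iff.mpr fun j => measurable_pi_apply _))

lemma sum_lintegral_eval {E : Type*} [MeasurableSpace E] (μ : Measure E)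
    [IsProbabilityMeasure μ] {g : E → ENNReal} (hg : Measurable g) :
    ∫⁻ D : Fin (n + 1) → E, ∑ i, g (D i) ∂(Measure.pi fun _ => μ) =
      ((n + 1 : ℕ) : ENNReal) * ∫⁻ w, g w ∂μ := by
  have h := fun i => (measurePreserving_eval (fun _ : Fin (n + 1) => μ) i).lintegral_comp hg
  simp only [Function.eval] at h
  rw [lintegral_finsetSum, Finset.sum_congr rfl fun i _ => h i,
    Finset.sum_const, Finset.card_univ, Fintype.card_fin, nsmul_eq_mul]
  exact fun i _ => hg.comp (measurable_pi_apply i)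

/-- The average of the leave-one-out bound over the training data and a fresh data point. -/
lemma lintegral_looBound_le (μ : Measure ((Fin K → ℝ) × ℝ)) [IsProbabilityMeasure μ] (A : ℝ)
    (β : Fin K → ℝ) :
    ∫⁻ D : Fin n → (Fin K → ℝ) × ℝ, ∫⁻ w, ENNReal.ofReal (looBound A w D) ∂μ
        ∂(Measure.pi fun _ => μ) ≤
      4 * ∫⁻ w, ENNReal.ofReal ((w.2 - β ⬝ᵥ w.1) ^ 2) ∂μ +
        ENNReal.ofReal (8 * A ^ 2 * K / (n + 1)) := by
  have hG : Measurable fun q : ((Fin K → ℝ) × ℝ) × (Fin n → (Fin K → ℝ) × ℝ) =>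
      ENNReal.ofReal (looBound A q.1 q.2) := (measurable_looBound A).ennreal_ofReal
  set L := ∫⁻ D : Fin n → (Fin K → ℝ) × ℝ, ∫⁻ w, ENNReal.ofReal (looBound A w D) ∂μ
        ∂(Measure.pi fun _ => μ) with hL
  set R := ∫⁻ w, ENNReal.ofReal ((w.2 - β ⬝ᵥ w.1) ^ 2) ∂μ with hR
  have hmeas : Measurable fun w : (Fin K → ℝ) × ℝ => ENNReal.ofReal ((w.2 - β ⬝ᵥ w.1) ^ 2) := by
    refine Measurable.ennreal_ofReal (Continuous.measurable ?_)
    fun_prop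
  -- A fresh point and `n` training points form `n + 1` i.i.d. points, and each may play the role of
  -- the fresh one. So `(n + 1) L` is the expected sum of the leave-one-out bounds, to which the
  -- deterministic estimate applies.
  have key : ((n + 1 : ℕ) : ENNReal) * L ≤
      ((n + 1 : ℕ) : ENNReal) * (4 * R) + ENNReal.ofReal (8 * A ^ 2 * K) := by
    have hsum := sum_lintegral_removeNth (n := n) μ hG
    have hsum' := sum_lintegral_eval (n := n) μ (hmeas.const_mul 4)
    rw [lintegral_const_mul _ hmeas] at hsum'
    rw [← hsum, ← hsum', ← mul_one (ENNReal.ofReal _),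
      ← measure_univ (μ := Measure.pi fun _ : Fin (n + 1) => μ), ← lintegral_const,
      ← lintegral_add_right _ measurable_const]
    refine lintegral_mono fun D => ?_
    dsimp only
    rw [← ENNReal.ofReal_sum_of_nonneg fun i _ => looBound_nonneg _ _ _]
    refine (ENNReal.ofReal_le_ofReal (sum_looBound_le A D β)).trans ?_
    rw [ENNReal.ofReal_add (mul_nonneg (by norm_num) (rss_nonneg D β)) (by positivity),
      ENNReal.ofReal_mul (by norm_num), rss,
      ENNReal.ofReal_sum_of_nonneg fun i _ => sq_nonneg _, Finset.mul_sum,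
      ENNReal.ofReal_ofNat]
  have hn0 : ((n + 1 : ℕ) : ENNReal) ≠ 0 := by simp
  have hnt : ((n + 1 : ℕ) : ENNReal) ≠ ⊤ := ENNReal.natCast_ne_top _
  rw [← ENNReal.mul_le_mul_iff_right hn0 hnt, mul_add]
  refine key.trans_eq ?_
  congr 1
  rw [← ENNReal.ofReal_natCast, ← ENNReal.ofReal_mul (by positivity)]
  congr 1
  push_cast
  field_simp

/-- The expected risk of truncated linear least squares estimates, with arbitrary choices of the
least squares coefficients, for noiseless responses bounded by `A`. -/
theorem lintegral_truncated_leastSquares_le {Ω : Type*} [MeasurableSpace Ω] {P : Measure Ω}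
    {W : Fin n → Ω → (Fin K → ℝ) × ℝ} (hW : ∀ i, Measurable (W i))
    {μ : Measure ((Fin K → ℝ) × ℝ)} [IsProbabilityMeasure μ]
    (hlaw : P.map (fun ω i => W i ω) = Measure.pi fun _ => μ)
    {A : ℝ} (hA : ∀ᵐ w ∂μ, |w.2| ≤ A) {b : Ω → Fin K → ℝ}
    (hb : ∀ᵐ ω ∂P, ∀ γ, rss (fun i => W i ω) (b ω) ≤ rss (fun i => W i ω) γ) (β : Fin K → ℝ) :
    ∫⁻ ω, ∫⁻ w, ENNReal.ofReal ((truncate A (b ω ⬝ᵥ w.1) - w.2) ^ 2) ∂μ ∂P ≤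
      4 * ∫⁻ w, ENNReal.ofReal ((w.2 - β ⬝ᵥ w.1) ^ 2) ∂μ +
        ENNReal.ofReal (8 * A ^ 2 * K / (n + 1)) := by
  refine le_trans ?_ (lintegral_looBound_le (n := n) μ A β)
  have hG : Measurable fun q : ((Fin K → ℝ) × ℝ) × (Fin n → (Fin K → ℝ) × ℝ) =>
      ENNReal.ofReal (looBound A q.1 q.2) := (measurable_looBound A).ennreal_ofReal
  -- The bound depends on the data only, so it can be pulled back to `Ω` and compared pointwise with
  -- the error of whichever minimiser `b ω` is.
  rw [← hlaw, lintegral_map hG.lintegral_prod_left' (measurable_pi_iff.mpr hW)]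
  refine lintegral_mono_ae ?_
  filter_upwards [hb] with ω hω
  refine lintegral_mono_ae ?_
  filter_upwards [hA] with w hw
  exact ENNReal.ofReal_le_ofReal (sq_truncate_sub_le_looBound hw hω)

end Regression

/-! ### The noise of a scheme of order two -/

section NoiseValues

variable {m : ℕ}

lemma mem_valuesXi {y : Fin m → ℝ} :
    y ∈ valuesXi m ↔ ∀ i, y i = -√3 ∨ y i = 0 ∨ y i = √3 := by
  simp [valuesXi]

lemma mem_valuesV {z : Pairs m → ℝ} : z ∈ valuesV m ↔ ∀ p, z p = -1 ∨ z p = 1 := by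
  simp [valuesV]

lemma card_pairs (m : ℕ) : Fintype.card (Pairs m) = m * (m - 1) / 2 := by
  have h2 : 2 * Fintype.card (Pairs m) = m * (m - 1) := by
    have hswap : (Finset.univ.filter fun p : Fin m × Fin m => p.1 < p.2).card =
        (Finset.univ.filter fun p : Fin m × Fin m => p.2 < p.1).card :=
      Finset.card_equiv (Equiv.prodComm _ _) (by simp)
    have hoff : (Finset.univ.filter fun p : Fin m × Fin m => p.1 < p.2) ∪
        (Finset.univ.filter fun p : Fin m × Fin m => p.2 < p.1) = Finset.univ.offDiag := by
      ext p; simp [Finset.mem_offDiag, lt_or_lt_iff_ne]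
    have hdisj : Disjoint (Finset.univ.filter fun p : Fin m × Fin m => p.1 < p.2)
        (Finset.univ.filter fun p : Fin m × Fin m => p.2 < p.1) := by
      rw [Finset.disjoint_filter]
      exact fun p _ h => h.not_gt
    have h := Finset.card_union_of_disjoint hdisj
    rw [hoff, ← hswap, Finset.offDiag_card, Finset.card_univ, Fintype.card_fin] at h
    rw [Fintype.card_subtype, Nat.mul_sub_one]
    omega
  omega

lemma neg_sqrt_three_ne_zero : -√3 ≠ 0 := by simp

lemma neg_sqrt_three_ne : -√3 ≠ √3 := by
  have : 0 < √3 := by positivity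
  linarith

lemma zero_ne_sqrt_three : (0 : ℝ) ≠ √3 := by
  have : 0 < √3 := by positivity
  linarith

lemma card_valuesXi (m : ℕ) : (valuesXi m).card = 3 ^ m := by
  have : ({-√3, 0, √3} : Finset ℝ).card = 3 := by
    rw [Finset.card_eq_three]
    exact ⟨_, _, _, neg_sqrt_three_ne_zero, neg_sqrt_three_ne, zero_ne_sqrt_three, rfl⟩
  simp [valuesXi, this]

lemma card_valuesV (m : ℕ) : (valuesV m).card = 2 ^ (m * (m - 1) / 2) := by
  have : ({-1, 1} : Finset ℝ).card = 2 := Finset.card_pair (by norm_num)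
  simp [valuesV, this, card_pairs]

lemma prob_eq_prod (y : Fin m → ℝ) :
    prob y = (∏ i, if y i = 0 then (2 / 3 : ℝ) else 1 / 6) *
      (1 / 2 : ℝ) ^ Fintype.card (Pairs m) := by
  have h : ∀ i, (if y i = 0 then (2 / 3 : ℝ) else 1 / 6) = (if y i = 0 then 4 else 1) / 6 := by
    intro i; split_ifs <;> norm_num
  rw [prob, card_pairs, Finset.prod_congr rfl fun i _ => h i, Finset.prod_div_distrib,
    Finset.prod_ite, Finset.prod_const, Finset.prod_const_one, Finset.prod_const,
    Finset.card_univ, Fintype.card_fin]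
  field_simp
  rw [← mul_pow]
  norm_num

lemma prob_pos (y : Fin m → ℝ) : 0 < prob y := by unfold prob; positivity

lemma sum_mul_sq_hermite (o : Fin 3) :
    ∑ t ∈ ({-√3, 0, √3} : Finset ℝ),
      (if t = 0 then (2 / 3 : ℝ) else 1 / 6) * hermite o t ^ 2 = 1 := by
  have h3 : (√3) ^ 2 = 3 := Real.sq_sqrt (by norm_num)
  have h2 : (√2) ^ 2 = 2 := Real.sq_sqrt (by norm_num)
  rw [Finset.sum_insert, Finset.sum_pair]
  · fin_cases o <;> simp [hermite, div_pow, h2, h3] <;> norm_num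
  · simpa using zero_ne_sqrt_three
  · simp [neg_sqrt_three_ne]

/-- Summation over `z` removes the power of two in `prob`; the rest factorises over coordinates, and
each `H_0`, `H_1`, `H_2` has second moment one under the three-point law. -/
lemma sum_prob_mul_sq_hermiteProd (o : Fin m → Fin 3) :
    ∑ y ∈ valuesXi m, ∑ _z ∈ valuesV m, prob y * hermiteProd o y ^ 2 = 1 := by
  have h : ∀ y : Fin m → ℝ, ∑ _z ∈ valuesV m, prob y * hermiteProd o y ^ 2 =
      ∏ i, (if y i = 0 then (2 / 3 : ℝ) else 1 / 6) * hermite (o i) (y i) ^ 2 := by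
    intro y
    rw [Finset.sum_const, card_valuesV, nsmul_eq_mul, prob_eq_prod, card_pairs, hermiteProd,
      Finset.prod_mul_distrib, Finset.prod_pow, Nat.cast_pow, Nat.cast_ofNat, div_pow, one_pow]
    field_simp
  rw [Finset.sum_congr rfl fun y _ => h y, valuesXi,
    ← Finset.prod_univ_sum (fun _ => {-√3, 0, √3})
      (fun i t => (if t = 0 then (2 / 3 : ℝ) else 1 / 6) * hermite (o i) t ^ 2)]
  exact Finset.prod_eq_one fun i _ => sum_mul_sq_hermite (o i)

lemma sq_signProd (r : Pairs m → Fin 2) {z : Pairs m → ℝ} (hz : z ∈ valuesV m) :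
    signProd r z ^ 2 = 1 := by
  rw [signProd, ← Finset.prod_pow]
  refine Finset.prod_eq_one fun p _ => ?_
  have : z p ^ 2 = 1 := by rcases mem_valuesV.mp hz p with h | h <;> simp [h]
  rw [← pow_mul, mul_comm, pow_mul, this, one_pow]

end NoiseValues

/-! ### Independence and atoms of the noise -/

section NoiseLaw

variable {Ω : Type*} [MeasurableSpace Ω] {m J : ℕ} {P : Measure Ω} {ν : Noise Ω m}

/-- The coordinates of the noise. -/
def Noise.coord {Ω : Type*} {m : ℕ} (ν : Noise Ω m) (J : ℕ)
    (c : Finset.Icc 1 J × (Fin m ⊕ Pairs m)) (ω : Ω) : ℝ :=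
  Sum.elim (ν.xi c.1 ω) (ν.V c.1 ω) c.2

/-- The `σ`-algebra generated by the noise at the times in `T`. -/
@[reducible] def Noise.sigma {Ω : Type*} {m : ℕ} (ν : Noise Ω m) (J : ℕ) (T : Set ℕ) :
    MeasurableSpace Ω :=
  ⨆ c ∈ {c : Finset.Icc 1 J × (Fin m ⊕ Pairs m) | (c.1 : ℕ) ∈ T},
    MeasurableSpace.comap (ν.coord J c) inferInstance

lemma Noise.measurable_sigma {Ω : Type*} (ν : Noise Ω m) {T : Set ℕ} {j : ℕ} (hj : j ∈ Finset.Icc 1 J)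
    (hT : j ∈ T) : Measurable[ν.sigma J T] (ν.xi j) ∧ Measurable[ν.sigma J T] (ν.V j) := by
  have h : ∀ a, Measurable[ν.sigma J T] (ν.coord J (⟨j, hj⟩, a)) := fun a =>
    (comap_measurable _).mono (le_biSup (fun c => MeasurableSpace.comap (ν.coord J c) inferInstance)
      (show (⟨j, hj⟩, a) ∈ {c : Finset.Icc 1 J × (Fin m ⊕ Pairs m) | (c.1 : ℕ) ∈ T} from hT)) le_rfl
  let _ := ν.sigma J T
  exact ⟨measurable_pi_iff.mpr fun i => h (Sum.inl i), measurable_pi_iff.mpr fun p => h (Sum.inr p)⟩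

namespace Noise.IsOrderTwo

lemma measurable_coord (h : ν.IsOrderTwo J P) (c : Finset.Icc 1 J × (Fin m ⊕ Pairs m)) :
    Measurable (ν.coord J c) := by
  obtain ⟨j, i | p⟩ := c
  · exact (measurable_pi_apply i).comp (h.measurable_xi j j.2)
  · exact (measurable_pi_apply p).comp (h.measurable_V j j.2)

lemma indep_sigma (h : ν.IsOrderTwo J P) {T T' : Set ℕ} (hT : Disjoint T T') :
    Indep (ν.sigma J T) (ν.sigma J T') P := by
  refine indep_iSup_of_disjoint (fun c => (h.measurable_coord c).comap_le) h.indep ?_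
  exact Set.disjoint_left.mpr fun c hc hc' => Set.disjoint_left.mp hT hc hc'

lemma measure_eq (h : ν.IsOrderTwo J P) {j : ℕ} (hj : j ∈ Finset.Icc 1 J) {y : Fin m → ℝ}
    (hy : y ∈ valuesXi m) {z : Pairs m → ℝ} (hz : z ∈ valuesV m) :
    P {ω | ν.xi j ω = y ∧ ν.V j ω = z} = ENNReal.ofReal (prob y) := by
  classical
  let e : (Fin m ⊕ Pairs m) ↪ Finset.Icc 1 J × (Fin m ⊕ Pairs m) :=
    ⟨fun a => (⟨j, hj⟩, a), fun a b hab => (Prod.ext_iff.mp hab).2⟩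
  have hind := iIndepFun.measure_inter_preimage_eq_mul h.indep (Finset.univ.map e)
    (sets := fun c => {Sum.elim y z c.2}) fun c _ => measurableSet_singleton _
  have hset : {ω | ν.xi j ω = y ∧ ν.V j ω = z} = ⋂ c ∈ Finset.univ.map e,
      (fun ω : Ω => Sum.elim (ν.xi c.1 ω) (ν.V c.1 ω) c.2) ⁻¹' {Sum.elim y z c.2} := by
    ext ω
    refine ⟨fun ⟨h1, h2⟩ => Set.mem_iInter₂.mpr fun c hc => ?_, fun hc => ?_⟩
    · obtain ⟨i | p, -, rfl⟩ := Finset.mem_map.mp hc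
      · exact congrFun h1 i
      · exact congrFun h2 p
    · have h' := fun a => Set.mem_iInter₂.mp hc (e a) (Finset.mem_map_of_mem e (Finset.mem_univ a))
      exact ⟨funext fun i => h' (Sum.inl i), funext fun p => h' (Sum.inr p)⟩
  rw [hset, hind, Finset.prod_map, Fintype.prod_sum_type, prob_eq_prod,
    ENNReal.ofReal_mul (Finset.prod_nonneg fun i _ => by split_ifs <;> norm_num),
    ENNReal.ofReal_prod_of_nonneg fun i _ => by split_ifs <;> norm_num]
  congr 1
  · refine Finset.prod_congr rfl fun i _ => ?_
    change P {ω | ν.xi j ω i = y i} = _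
    rcases mem_valuesXi.mp hy i with hi | hi | hi
    · rw [hi, h.xi_neg j hj i, if_neg neg_sqrt_three_ne_zero,
        ENNReal.ofReal_div_of_pos (by norm_num)]; simp
    · rw [hi, h.xi_zero j hj i, if_pos rfl, ENNReal.ofReal_div_of_pos (by norm_num)]; simp
    · rw [hi, h.xi_pos j hj i, if_neg (by simp), ENNReal.ofReal_div_of_pos (by norm_num)]; simp
  · have : ∀ p, P {ω | ν.V j ω p = z p} = ENNReal.ofReal (1 / 2) := by
      intro p
      rw [ENNReal.ofReal_div_of_pos (by norm_num)]
      rcases mem_valuesV.mp hz p with hp | hp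
      · rw [hp, h.V_neg j hj p]; simp
      · rw [hp, h.V_pos j hj p]; simp
    rw [ENNReal.ofReal_pow (by norm_num), ← Finset.card_univ, ← Finset.prod_const]
    exact Finset.prod_congr rfl fun p _ => this p

lemma ae_mem [IsProbabilityMeasure P] (h : ν.IsOrderTwo J P) {j : ℕ} (hj : j ∈ Finset.Icc 1 J) :
    ∀ᵐ ω ∂P, ν.xi j ω ∈ valuesXi m ∧ ν.V j ω ∈ valuesV m := by
  have hcover : ∀ (X : Ω → ℝ) (_ : Measurable X) (s : Finset ℝ)
      (_ : ∑ t ∈ s, P {ω | X ω = t} = 1), ∀ᵐ ω ∂P, X ω ∈ s := by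
    intro X hX s hs
    have h1 : P (X ⁻¹' ↑s) = 1 := by
      rw [← hs, ← Measure.map_apply hX s.measurableSet, ← sum_measure_singleton]
      exact Finset.sum_congr rfl fun t _ => Measure.map_apply hX (measurableSet_singleton t)
    have := (prob_compl_eq_zero_iff (hX s.measurableSet)).mpr h1
    exact this
  have hxi : ∀ i, ∀ᵐ ω ∂P, ν.xi j ω i ∈ ({-√3, 0, √3} : Finset ℝ) := by
    refine fun i => hcover (fun ω => ν.xi j ω i) (h.measurable_coord (⟨j, hj⟩, Sum.inl i)) _ ?_
    rw [Finset.sum_insert (by simp [neg_sqrt_three_ne]), Finset.sum_pair zero_ne_sqrt_three,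
      h.xi_neg j hj, h.xi_zero j hj, h.xi_pos j hj, ← ENNReal.toReal_eq_one_iff,
      ENNReal.toReal_add, ENNReal.toReal_add] <;> norm_num [ENNReal.div_eq_top]
  have hV : ∀ p, ∀ᵐ ω ∂P, ν.V j ω p ∈ ({-1, 1} : Finset ℝ) := by
    refine fun p => hcover (fun ω => ν.V j ω p) (h.measurable_coord (⟨j, hj⟩, Sum.inr p)) _ ?_
    rw [Finset.sum_pair (by norm_num), h.V_neg j hj, h.V_pos j hj]
    exact ENNReal.add_halves 1
  filter_upwards [ae_all_iff.mpr hxi, ae_all_iff.mpr hV] with ω h1 h2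
  exact ⟨Fintype.mem_piFinset.mpr h1, Fintype.mem_piFinset.mpr h2⟩

lemma measurable_pair (h : ν.IsOrderTwo J P) {j : ℕ} (hj : j ∈ Finset.Icc 1 J) :
    Measurable fun ω => (ν.xi j ω, ν.V j ω) :=
  (h.measurable_xi j hj).prodMk (h.measurable_V j hj)

lemma map_singleton (h : ν.IsOrderTwo J P) {j : ℕ} (hj : j ∈ Finset.Icc 1 J) {y : Fin m → ℝ}
    (hy : y ∈ valuesXi m) {z : Pairs m → ℝ} (hz : z ∈ valuesV m) :
    P.map (fun ω => (ν.xi j ω, ν.V j ω)) {(y, z)} = ENNReal.ofReal (prob y) := by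
  rw [Measure.map_apply (h.measurable_pair hj) (measurableSet_singleton _),
    ← h.measure_eq hj hy hz]
  congr 1
  ext ω; simp

lemma map_apply_eq_sum [IsProbabilityMeasure P] (h : ν.IsOrderTwo J P) {j : ℕ}
    (hj : j ∈ Finset.Icc 1 J) {B : Set ((Fin m → ℝ) × (Pairs m → ℝ))} (hB : MeasurableSet B)
    [DecidablePred (· ∈ B)] :
    P.map (fun ω => (ν.xi j ω, ν.V j ω)) B =
      ∑ t ∈ (valuesXi m ×ˢ valuesV m).filter (· ∈ B), ENNReal.ofReal (prob t.1) := by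
  have hm := h.measurable_pair hj
  have h1 : P.map (fun ω => (ν.xi j ω, ν.V j ω)) B = P.map (fun ω => (ν.xi j ω, ν.V j ω))
      ↑((valuesXi m ×ˢ valuesV m).filter (· ∈ B)) := by
    rw [Measure.map_apply hm hB, Measure.map_apply hm (Finset.measurableSet _)]
    refine measure_congr ?_
    filter_upwards [h.ae_mem hj] with ω hω
    refine propext ?_
    change (ν.xi j ω, ν.V j ω) ∈ B ↔ (ν.xi j ω, ν.V j ω) ∈ Finset.filter _ _
    simp [hω.1, hω.2]
  rw [h1, ← sum_measure_singleton]
  refine Finset.sum_congr rfl fun t ht => ?_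
  have ht' := Finset.mem_product.mp (Finset.mem_filter.mp ht).1
  exact h.map_singleton hj ht'.1 ht'.2

/-- The law is purely atomic with masses given by `prob`. This transfers statements between the
training noises and `ν`. -/
lemma map_pair_eq [IsProbabilityMeasure P] {ν' : Noise Ω m} (h : ν.IsOrderTwo J P)
    (h' : ν'.IsOrderTwo J P) {j : ℕ} (hj : j ∈ Finset.Icc 1 J) :
    P.map (fun ω => (ν.xi j ω, ν.V j ω)) = P.map (fun ω => (ν'.xi j ω, ν'.V j ω)) := by
  classical
  ext B hB
  rw [h.map_apply_eq_sum hj hB, h'.map_apply_eq_sum hj hB]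

end Noise.IsOrderTwo

end NoiseLaw

/-! ### The chain, its law, and its conditional expectations -/

section Chain

variable {Ω : Type*} {d m : ℕ} (S : Scheme d m)

/-- The definition splits off the last step; conditioning on the next noise requires splitting off
the first. -/
lemma Scheme.chainFrom_succ_left (ν : Noise Ω m) (ω : Ω) (s : ℕ) (x : Fin d → ℝ) (n : ℕ) :
    S.chainFrom ν ω s x (n + 1) =
      S.chainFrom ν ω (s + 1) (S.Φ x (ν.xi (s + 1) ω) (ν.V (s + 1) ω)) n := by
  induction n with
  | zero => rfl
  | succ n ih =>
    rw [Scheme.chainFrom, ih, Scheme.chainFrom]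
    congr 2 <;> ring

/-- The `σ`-algebra on `Ω` is left free, so that it can also be one generated by part of the noise;
this yields the independence of past, present and future. -/
lemma Scheme.measurable_chainFrom [MeasurableSpace Ω] {ν : Noise Ω m} {s n : ℕ}
    (h : ∀ j ∈ Finset.Icc (s + 1) (s + n), Measurable (ν.xi j) ∧ Measurable (ν.V j)) :
    Measurable fun q : (Fin d → ℝ) × Ω => S.chainFrom ν q.2 s q.1 n := by
  induction n with
  | zero => exact measurable_fst
  | succ n ih =>
    have ih' := ih fun j hj => h j (Finset.Icc_subset_Icc_right (by omega) hj)
    obtain ⟨h1, h2⟩ := h (s + n + 1) (Finset.mem_Icc.mpr ⟨by omega, by omega⟩)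
    exact S.measurable_Φ.comp
      (ih'.prodMk ((h1.comp measurable_snd).prodMk (h2.comp measurable_snd)))

lemma Scheme.measurable_path [MeasurableSpace Ω] {ν : Noise Ω m} {n : ℕ}
    (h : ∀ j ∈ Finset.Icc 1 n, Measurable (ν.xi j) ∧ Measurable (ν.V j)) :
    Measurable (S.path ν n) :=
  (S.measurable_chainFrom (s := 0) (n := n) (by simpa using h)).comp
    (measurable_const.prodMk measurable_id)

variable [MeasurableSpace Ω] {ν : Noise Ω m} {P : Measure Ω} {j : ℕ}

lemma Noise.IsOrderTwo.measurable {J : ℕ} (h : ν.IsOrderTwo J P) (hj : j ∈ Finset.Icc 1 J) :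
    Measurable (ν.xi j) ∧ Measurable (ν.V j) :=
  ⟨h.measurable_xi j hj, h.measurable_V j hj⟩

lemma Scheme.measurable_path_of_isOrderTwo (h : ν.IsOrderTwo S.J P) (hj : j ≤ S.J) :
    Measurable (S.path ν j) :=
  S.measurable_path fun _ hi => h.measurable (Finset.Icc_subset_Icc_right hj hi)

lemma Scheme.measurable_terminal (h : ν.IsOrderTwo S.J P) (hj : j ≤ S.J) :
    Measurable fun q : (Fin d → ℝ) × Ω => S.terminal ν j q.1 q.2 :=
  S.measurable_chainFrom fun i hi => h.measurable <| by
    rw [Finset.mem_Icc] at hi ⊢; omega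

lemma Scheme.measurable_q [IsProbabilityMeasure P] (h : ν.IsOrderTwo S.J P) (hj : j ≤ S.J) :
    Measurable (S.q ν P j) :=
  ((S.measurable_f.comp (S.measurable_terminal h hj)).stronglyMeasurable.integral_prod_right'
    (ν := P)).measurable

lemma Scheme.measurable_h [IsProbabilityMeasure P] (h : ν.IsOrderTwo S.J P) (hj : j ≤ S.J)
    (y : Fin m → ℝ) (z : Pairs m → ℝ) : Measurable (S.h ν P j y z) :=
  (S.measurable_q h hj).comp
    (S.measurable_Φ.comp (measurable_id.prodMk (measurable_const (a := (y, z)))))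

lemma Scheme.indepFun_path_noise (h : ν.IsOrderTwo S.J P) (hj : j ∈ Finset.Icc 1 S.J) :
    IndepFun (S.path ν (j - 1)) (fun ω => (ν.xi j ω, ν.V j ω)) P := by
  have hj' := Finset.mem_Icc.mp hj
  have hT : Disjoint {i : ℕ | i < j} {j} := by simp
  rw [IndepFun_iff_Indep]
  refine indep_of_indep_of_le_right (indep_of_indep_of_le_left (h.indep_sigma hT) ?_) ?_
  · refine Measurable.comap_le ?_
    refine @Scheme.measurable_path Ω d m S (ν.sigma S.J _) ν (j - 1) fun i hi => ?_
    have hi' := Finset.mem_Icc.mp hi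
    exact ν.measurable_sigma (Finset.mem_Icc.mpr ⟨by omega, by omega⟩)
      (show i < j by omega)
  · have hm := ν.measurable_sigma hj (Set.mem_singleton j)
    refine Measurable.comap_le ?_
    let _ := ν.sigma S.J {j}
    exact hm.1.prodMk hm.2

lemma Scheme.indepFun_noise_terminal (h : ν.IsOrderTwo S.J P) (hj : j ∈ Finset.Icc 1 S.J)
    (x : Fin d → ℝ) :
    IndepFun (fun ω => (ν.xi j ω, ν.V j ω)) (S.terminal ν j x) P := by
  have hj' := Finset.mem_Icc.mp hj
  have hT : Disjoint {j} {i : ℕ | j < i} := by simp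
  rw [IndepFun_iff_Indep]
  refine indep_of_indep_of_le_right (indep_of_indep_of_le_left (h.indep_sigma hT) ?_) ?_
  · have hm := ν.measurable_sigma hj (Set.mem_singleton j)
    refine Measurable.comap_le ?_
    let _ := ν.sigma S.J {j}
    exact hm.1.prodMk hm.2
  · refine Measurable.comap_le ?_
    let _ := ν.sigma S.J {i : ℕ | j < i}
    refine (S.measurable_chainFrom (ν := ν) (s := j) (n := S.J - j) fun i hi => ?_).comp
      (measurable_const.prodMk measurable_id)
    have hi' := Finset.mem_Icc.mp hi
    exact ν.measurable_sigma (Finset.mem_Icc.mpr ⟨by omega, by omega⟩)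
      (show j < i by omega)

/-- The joint law of the position and of the noise that drives the next step. -/
lemma Scheme.map_path_noise [IsProbabilityMeasure P] (h : ν.IsOrderTwo S.J P)
    (hj : j ∈ Finset.Icc 1 S.J) :
    P.map (fun ω => (S.path ν (j - 1) ω, (ν.xi j ω, ν.V j ω))) =
      (S.law ν P (j - 1)).prod (P.map fun ω => (ν.xi j ω, ν.V j ω)) := by
  have hj' := Finset.mem_Icc.mp hj
  exact (indepFun_iff_map_prod_eq_prod_map_map
    (S.measurable_path_of_isOrderTwo h (by omega)).aemeasurable
    (h.measurable_pair hj).aemeasurable).mp (S.indepFun_path_noise h hj)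

/-- Markov property: the next law is the image under `Φ` of the product of the present law and the
noise law. -/
lemma Scheme.law_eq [IsProbabilityMeasure P] {ν' : Noise Ω m} (h : ν.IsOrderTwo S.J P)
    (h' : ν'.IsOrderTwo S.J P) (hj : j ≤ S.J) : S.law ν P j = S.law ν' P j := by
  induction j with
  | zero => rfl
  | succ j ih =>
    have hmem : j + 1 ∈ Finset.Icc 1 S.J := Finset.mem_Icc.mpr ⟨by omega, hj⟩
    have key : ∀ {μ : Noise Ω m}, μ.IsOrderTwo S.J P → S.law μ P (j + 1) =
        ((S.law μ P j).prod (P.map fun ω => (μ.xi (j + 1) ω, μ.V (j + 1) ω))).map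
          fun u => S.Φ u.1 u.2.1 u.2.2 := by
      intro μ hμ
      have := S.map_path_noise hμ hmem
      rw [Nat.add_sub_cancel] at this
      rw [← this, Measure.map_map S.measurable_Φ
        ((S.measurable_path_of_isOrderTwo hμ (by omega)).prodMk (hμ.measurable_pair hmem))]
      have : S.path μ (j + 1) = fun ω =>
          S.Φ (S.path μ j ω) (μ.xi (j + 1) ω) (μ.V (j + 1) ω) := by
        funext ω
        simp only [Scheme.path, Scheme.chainFrom, Nat.zero_add]
      rw [Scheme.law, this]
      rfl
    rw [key h, key h', ih (by omega), h.map_pair_eq h' hmem]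

/-- The noise has finitely many values. Integrability of `f` at the terminal position therefore
needs no growth condition. -/
lemma Scheme.exists_finset_chainFrom [IsProbabilityMeasure P] (h : ν.IsOrderTwo S.J P) {s n : ℕ}
    (hn : s + n ≤ S.J) (x : Fin d → ℝ) :
    ∃ F : Finset (Fin d → ℝ), ∀ᵐ ω ∂P, S.chainFrom ν ω s x n ∈ F := by
  classical
  induction n with
  | zero => exact ⟨{x}, by simp [Scheme.chainFrom]⟩
  | succ n ih =>
    obtain ⟨F, hF⟩ := ih (by omega)
    refine ⟨(F ×ˢ valuesXi m ×ˢ valuesV m).image fun u => S.Φ u.1 u.2.1 u.2.2, ?_⟩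
    filter_upwards [hF, h.ae_mem (j := s + n + 1) (Finset.mem_Icc.mpr ⟨by omega, by omega⟩)]
      with ω h1 h2
    exact Finset.mem_image.mpr ⟨(_, _, _),
      Finset.mem_product.mpr ⟨h1, Finset.mem_product.mpr ⟨h2.1, h2.2⟩⟩, rfl⟩

lemma Scheme.integrable_terminal [IsProbabilityMeasure P] (h : ν.IsOrderTwo S.J P) (hj : j ≤ S.J)
    (x : Fin d → ℝ) : Integrable (fun ω => S.f (S.terminal ν j x ω)) P := by
  obtain ⟨F, hF⟩ := S.exists_finset_chainFrom h (s := j) (n := S.J - j) (by omega) x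
  refine Integrable.of_bound (S.measurable_f.comp ((S.measurable_terminal h hj).comp
    (measurable_const.prodMk measurable_id))).aestronglyMeasurable (∑ u ∈ F, ‖S.f u‖) ?_
  filter_upwards [hF] with ω hω
  exact Finset.single_le_sum (f := fun u => ‖S.f u‖) (fun _ _ => norm_nonneg _) hω

/-- The coefficients `a_{j,o,r}` as weighted sums of the functions `h_{j,y,z}`. -/
lemma Scheme.a_eq_sum [IsProbabilityMeasure P] (h : ν.IsOrderTwo S.J P)
    (hj : j ∈ Finset.Icc 1 S.J) (o : Fin m → Fin 3) (r : Pairs m → Fin 2) (x : Fin d → ℝ) :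
    S.a ν P j o r x = ∑ y ∈ valuesXi m, ∑ z ∈ valuesV m,
      prob y * hermiteProd o y * signProd r z * S.h ν P j y z x := by
  classical
  have hj' := Finset.mem_Icc.mp hj
  -- The noise of step `j` is frozen at `t`: the indicator depends on that noise and the payoff only
  -- on later noise, so the expectation factorises.
  let g : (Fin m → ℝ) × (Pairs m → ℝ) → Ω → ℝ := fun t ω =>
    Set.indicator {t} (fun _ => (1 : ℝ)) (ν.xi j ω, ν.V j ω) *
      S.f (S.terminal ν j (S.Φ x t.1 t.2) ω)
  have hind : ∀ t : (Fin m → ℝ) × (Pairs m → ℝ),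
      Measurable (Set.indicator {t} fun _ => (1 : ℝ)) := fun t =>
    measurable_const.indicator (measurableSet_singleton t)
  have hint : ∀ t, Integrable (g t) P := fun t => by
    refine (S.integrable_terminal h hj'.2 (S.Φ x t.1 t.2)).bdd_mul (c := 1)
      ((hind t).comp (h.measurable_pair hj)).aestronglyMeasurable (.of_forall fun ω => ?_)
    by_cases hω : (ν.xi j ω, ν.V j ω) = t <;> simp [Set.indicator, hω]
  have hval : ∀ t ∈ valuesXi m ×ˢ valuesV m, ∫ ω, g t ω ∂P = prob t.1 * S.h ν P j t.1 t.2 x := by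
    intro t ht
    obtain ⟨ht1, ht2⟩ := Finset.mem_product.mp ht
    have hi := (S.indepFun_noise_terminal h hj (S.Φ x t.1 t.2)).comp (hind t) S.measurable_f
    have hmt : Measurable (S.terminal ν j (S.Φ x t.1 t.2)) :=
      (S.measurable_terminal h hj'.2).comp (measurable_const.prodMk measurable_id)
    have := hi.integral_fun_mul_eq_mul_integral
      ((hind t).comp (h.measurable_pair hj)).aestronglyMeasurable
      (S.measurable_f.comp hmt).aestronglyMeasurable
    refine this.trans ?_
    congr 1
    have h1 : (Set.indicator {t} fun _ => (1 : ℝ)) ∘ (fun ω => (ν.xi j ω, ν.V j ω)) =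
        Set.indicator {ω | ν.xi j ω = t.1 ∧ ν.V j ω = t.2} 1 := by
      funext ω
      by_cases hω : (ν.xi j ω, ν.V j ω) = t
      · simp [← hω]
      · have hω' : ¬ (ν.xi j ω = t.1 ∧ ν.V j ω = t.2) := fun hc => hω (Prod.ext hc.1 hc.2)
        simp [Set.indicator, hω, hω']
    have hms : MeasurableSet {ω | ν.xi j ω = t.1 ∧ ν.V j ω = t.2} :=
      ((measurableSet_singleton t.1).preimage (h.measurable_xi j hj)).inter
        ((measurableSet_singleton t.2).preimage (h.measurable_V j hj))
    rw [h1, integral_indicator_one hms, measureReal_def, h.measure_eq hj ht1 ht2,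
      ENNReal.toReal_ofReal (prob_pos _).le]
  have hae : (fun ω => S.f (S.terminal ν (j - 1) x ω) * hermiteProd o (ν.xi j ω) *
      signProd r (ν.V j ω)) =ᵐ[P] fun ω => ∑ t ∈ valuesXi m ×ˢ valuesV m,
        hermiteProd o t.1 * signProd r t.2 * g t ω := by
    filter_upwards [h.ae_mem hj] with ω hω
    rw [Finset.sum_eq_single (ν.xi j ω, ν.V j ω)]
    · have : S.terminal ν (j - 1) x ω =
          S.terminal ν j (S.Φ x (ν.xi j ω) (ν.V j ω)) ω := by
        obtain ⟨i, rfl⟩ : ∃ i, j = i + 1 := ⟨j - 1, by omega⟩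
        rw [Scheme.terminal, Scheme.terminal, Nat.add_sub_cancel,
          show S.J - i = S.J - (i + 1) + 1 by omega, S.chainFrom_succ_left]
      simp only [g, Set.indicator_of_mem (Set.mem_singleton _), this]
      ring
    · intro t _ ht
      simp [g, Set.indicator, ht.symm]
    · exact fun hn => absurd (Finset.mem_product.mpr ⟨hω.1, hω.2⟩) hn
  rw [Scheme.a, integral_congr_ae hae, integral_finsetSum _ fun t _ => (hint t).const_mul _,
    Finset.sum_product]
  refine Finset.sum_congr rfl fun y hy => Finset.sum_congr rfl fun z hz => ?_
  rw [integral_const_mul, hval (y, z) (Finset.mem_product.mpr ⟨hy, hz⟩)]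
  ring

end Chain

/-! ### Stratified regression -/

lemma measurable_truncate (A : ℝ) : Measurable (truncate A) := by
  unfold truncate
  refine Measurable.ite (measurableSet_le measurable_norm measurable_const) measurable_id ?_
  refine Measurable.const_mul ?_ A
  unfold Real.sign
  exact Measurable.ite measurableSet_Iio measurable_const
    (Measurable.ite measurableSet_Ioi measurable_const measurable_const)

lemma truncate_zero {A : ℝ} : truncate A 0 = 0 := by simp [truncate]

section Strata

variable {Ω : Type*} {d m K N : ℕ} (S : Scheme d m)

open Classical in
/-- The data point of the regression in the stratum of `t`: features and response in the stratum,
and zero outside of it. -/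
noncomputable def stratumPoint (ψ : Fin K → (Fin d → ℝ) → ℝ) (h : (Fin d → ℝ) → ℝ)
    (t : (Fin m → ℝ) × (Pairs m → ℝ)) (u : (Fin d → ℝ) × (Fin m → ℝ) × (Pairs m → ℝ)) :
    (Fin K → ℝ) × ℝ :=
  if u.2 = t then (fun k => ψ k u.1, h u.1) else 0

lemma measurable_stratumPoint {ψ : Fin K → (Fin d → ℝ) → ℝ} (hψ : ∀ k, Measurable (ψ k))
    {h : (Fin d → ℝ) → ℝ} (hh : Measurable h) (t : (Fin m → ℝ) × (Pairs m → ℝ)) :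
    Measurable (stratumPoint ψ h t) := by
  classical
  unfold stratumPoint
  refine Measurable.ite ((measurableSet_singleton t).preimage measurable_snd) ?_ measurable_const
  exact (measurable_pi_iff.mpr fun k => (hψ k).comp measurable_fst).prodMk (hh.comp measurable_fst)

/-- Outside the stratum the data point is `0`, where `F` vanishes, so only the atom `t` of the noise
law contributes. -/
lemma lintegral_map_stratumPoint {ψ : Fin K → (Fin d → ℝ) → ℝ} (hψ : ∀ k, Measurable (ψ k))
    {h : (Fin d → ℝ) → ℝ} (hh : Measurable h) (t : (Fin m → ℝ) × (Pairs m → ℝ))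
    (μ : Measure (Fin d → ℝ)) (ρ : Measure ((Fin m → ℝ) × (Pairs m → ℝ))) [IsFiniteMeasure ρ]
    {F : (Fin K → ℝ) × ℝ → ENNReal} (hF : Measurable F) (hF0 : F 0 = 0) :
    ∫⁻ w, F w ∂((μ.prod ρ).map (stratumPoint ψ h t)) =
      ρ {t} * ∫⁻ x, F (fun k => ψ k x, h x) ∂μ := by
  classical
  have hm := measurable_stratumPoint hψ hh t
  rw [lintegral_map hF hm,
    lintegral_prod (fun u => F (stratumPoint ψ h t u)) (hF.comp hm).aemeasurable,
    ← lintegral_const_mul' _ _ (measure_ne_top ρ _)]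
  refine lintegral_congr fun x => ?_
  have : (fun s => F (stratumPoint ψ h t (x, s))) =
      Set.indicator {t} fun _ => F (fun k => ψ k x, h x) := by
    funext s
    by_cases hs : s = t <;> simp [stratumPoint, Set.indicator, hs, hF0]
  rw [this, lintegral_indicator_const (measurableSet_singleton t), mul_comm]

variable [MeasurableSpace Ω] {P : Measure Ω} {ν : Noise Ω m}
  {τ : Fin N → Noise Ω m} {j : ℕ}

/-- Points outside the stratum have zero features and response, hence zero residual. This turns a
sample of random size into one of fixed size `N`, so empty strata need no separate treatment. -/
lemma residual_eq_rss (P : Measure Ω) (ν : Noise Ω m) (ψ : Fin K → (Fin d → ℝ) → ℝ)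
    (τ : Fin N → Noise Ω m) (hj : 1 ≤ j) (y : Fin m → ℝ) (z : Pairs m → ℝ) (ω : Ω)
    (β : Fin K → ℝ) :
    S.residual ν P ψ τ j y z ω β = rss (fun n => stratumPoint ψ (S.h ν P j y z) (y, z)
      (S.path (τ n) (j - 1) ω, ((τ n).xi j ω, (τ n).V j ω))) β := by
  classical
  rw [Scheme.residual, stratum, Finset.sum_filter, rss]
  refine Finset.sum_congr rfl fun n _ => ?_
  by_cases hn : (τ n).xi j ω = y ∧ (τ n).V j ω = z
  · have hpath : S.path (τ n) j ω = S.Φ (S.path (τ n) (j - 1) ω) y z := by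
      obtain ⟨i, rfl⟩ : ∃ i, j = i + 1 := ⟨j - 1, by omega⟩
      rw [← hn.1, ← hn.2]
      simp only [Scheme.path, Scheme.chainFrom, Nat.zero_add, Nat.add_sub_cancel]
    rw [if_pos hn, stratumPoint, if_pos (Prod.ext hn.1 hn.2), hpath]
    rfl
  · have : ¬ ((τ n).xi j ω, (τ n).V j ω) = (y, z) := fun h =>
      hn ⟨congrArg Prod.fst h, congrArg Prod.snd h⟩
    rw [if_neg hn, stratumPoint, if_neg this]
    simp

lemma IsTraining.iIndepFun_path_noise {J : ℕ} (hτ : IsTraining τ J P) (hj : j ∈ Finset.Icc 1 J) :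
    iIndepFun (fun n ω => (S.path (τ n) (j - 1) ω, ((τ n).xi j ω, (τ n).V j ω))) P := by
  rw [iIndepFun_iff_iIndep]
  refine iIndep_of_iIndep_of_le hτ.indep.iIndep fun n => Measurable.comap_le ?_
  let _ := MeasurableSpace.comap
    (fun (ω : Ω) (j : Finset.Icc 1 J) => ((τ n).xi j ω, (τ n).V j ω)) inferInstance
  have hcoord : ∀ i ∈ Finset.Icc 1 J, Measurable fun ω => ((τ n).xi i ω, (τ n).V i ω) :=
    fun i hi => (measurable_pi_apply (⟨i, hi⟩ : Finset.Icc 1 J)).comp (comap_measurable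
      (fun (ω : Ω) (j : Finset.Icc 1 J) => ((τ n).xi j ω, (τ n).V j ω)))
  have hj' := Finset.mem_Icc.mp hj
  refine Measurable.prodMk (S.measurable_path fun i hi => ?_) (hcoord j hj)
  have hi' := Finset.mem_Icc.mp hi
  have := hcoord i (Finset.mem_Icc.mpr ⟨by omega, by omega⟩)
  exact ⟨this.fst, this.snd⟩

variable [IsProbabilityMeasure P]

/-- The error of the truncated regression in one stratum. -/
lemma lintegral_stratum_le (hν : ν.IsOrderTwo S.J P) (hτ : IsTraining τ S.J P)
    {ψ : Fin K → (Fin d → ℝ) → ℝ} (hψ : ∀ k, Measurable (ψ k)) {A : ℝ}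
    (hA : S.Bounded ν P A) (hj : j ∈ Finset.Icc 1 S.J)
    {y : Fin m → ℝ} (hy : y ∈ valuesXi m) {z : Pairs m → ℝ} (hz : z ∈ valuesV m)
    {b : Ω → Fin K → ℝ}
    (hb : ∀ᵐ ω ∂P, ∀ β : Fin K → ℝ,
      S.residual ν P ψ τ j y z ω (b ω) ≤ S.residual ν P ψ τ j y z ω β)
    {g : (Fin d → ℝ) → ℝ} (hg : g ∈ Submodule.span ℝ (Set.range ψ)) :
    ∫⁻ ω, ∫⁻ x, ENNReal.ofReal ((truncate A (linComb ψ (b ω) x) - S.h ν P j y z x) ^ 2)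
        ∂(S.law ν P (j - 1)) ∂P ≤
      4 * ∫⁻ x, ENNReal.ofReal ((S.h ν P j y z x - g x) ^ 2) ∂(S.law ν P (j - 1)) +
        ENNReal.ofReal (8 * A ^ 2 * K / ((N + 1) * prob y)) := by
  have hj' := Finset.mem_Icc.mp hj
  obtain ⟨β, rfl⟩ := (Submodule.mem_span_range_iff_exists_fun ℝ).mp hg
  set h := S.h ν P j y z with hh
  have hhm : Measurable h := S.measurable_h hν hj'.2 y z
  have hpt := measurable_stratumPoint hψ hhm (y, z)
  have hpath : ∀ {ν' : Noise Ω m}, ν'.IsOrderTwo S.J P →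
      Measurable fun ω => (S.path ν' (j - 1) ω, (ν'.xi j ω, ν'.V j ω)) := fun h' =>
    (S.measurable_path_of_isOrderTwo h' (by omega)).prodMk (h'.measurable_pair hj)
  let ρ := P.map fun ω => (ν.xi j ω, ν.V j ω)
  have : IsProbabilityMeasure ρ :=
    Measure.isProbabilityMeasure_map (hν.measurable_pair hj).aemeasurable
  have : IsProbabilityMeasure (S.law ν P (j - 1)) :=
    Measure.isProbabilityMeasure_map (S.measurable_path_of_isOrderTwo hν (by omega)).aemeasurable
  let μ := ((S.law ν P (j - 1)).prod ρ).map (stratumPoint ψ h (y, z))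
  have : IsProbabilityMeasure μ := Measure.isProbabilityMeasure_map hpt.aemeasurable
  let W : Fin N → Ω → (Fin K → ℝ) × ℝ := fun n ω =>
    stratumPoint ψ h (y, z) (S.path (τ n) (j - 1) ω, ((τ n).xi j ω, (τ n).V j ω))
  have hWm : ∀ n, Measurable (W n) := fun n => hpt.comp (hpath (hτ.isOrderTwo n))
  have hWlaw : ∀ n, P.map (W n) = μ := by
    intro n
    have hn := hτ.isOrderTwo n
    have : W n = stratumPoint ψ h (y, z) ∘
        fun ω => (S.path (τ n) (j - 1) ω, ((τ n).xi j ω, (τ n).V j ω)) := rfl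
    rw [this, ← Measure.map_map hpt (hpath hn), S.map_path_noise hn hj,
      S.law_eq hn hν (by omega), hn.map_pair_eq hν hj]
  have hlaw : P.map (fun ω n => W n ω) = Measure.pi fun _ => μ := by
    have hi := (IsTraining.iIndepFun_path_noise S hτ hj).comp
      (fun _ => stratumPoint ψ h (y, z)) fun _ => hpt
    have := (iIndepFun_iff_map_fun_eq_pi_map (f := W) fun n => (hWm n).aemeasurable).mp hi
    rw [this]
    simp only [hWlaw]
  have hbdd : ∀ᵐ w ∂μ, |w.2| ≤ A := by
    refine (ae_map_iff hpt.aemeasurable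
      (measurableSet_le measurable_snd.abs measurable_const)).mpr (.of_forall fun u => ?_)
    have hx := hA j hj y hy z hz
    unfold stratumPoint
    split_ifs
    · exact hx u.1
    · simpa using (abs_nonneg _).trans (hx u.1)
  have main := lintegral_truncated_leastSquares_le hWm hlaw hbdd (b := b) (by
    filter_upwards [hb] with ω hω γ
    rw [← residual_eq_rss S P ν ψ τ hj'.1, ← residual_eq_rss S P ν ψ τ hj'.1]
    exact hω γ) β
  have hp : ρ {(y, z)} = ENNReal.ofReal (prob y) := hν.map_singleton hj hy hz
  have hp0 : ρ {(y, z)} ≠ 0 := by rw [hp]; simpa using prob_pos y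
  have hpt' : ρ {(y, z)} ≠ ⊤ := measure_ne_top _ _
  have hdot : ∀ c : Fin K → ℝ, Measurable fun w : (Fin K → ℝ) × ℝ => c ⬝ᵥ w.1 := fun c =>
    ((continuous_dotProduct_const c).comp continuous_fst).measurable
  have e1 : ∀ ω, ∫⁻ w, ENNReal.ofReal ((truncate A (b ω ⬝ᵥ w.1) - w.2) ^ 2) ∂μ =
      ρ {(y, z)} * ∫⁻ x, ENNReal.ofReal ((truncate A (linComb ψ (b ω) x) - h x) ^ 2)
        ∂(S.law ν P (j - 1)) := fun ω =>
    lintegral_map_stratumPoint hψ hhm (y, z) _ ρ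
      (F := fun w => ENNReal.ofReal ((truncate A (b ω ⬝ᵥ w.1) - w.2) ^ 2))
      ((((measurable_truncate A).comp (hdot _)).sub measurable_snd).pow_const 2).ennreal_ofReal
      (by simp [truncate_zero])
  have e2 : ∫⁻ w, ENNReal.ofReal ((w.2 - β ⬝ᵥ w.1) ^ 2) ∂μ =
      ρ {(y, z)} * ∫⁻ x, ENNReal.ofReal ((h x - (∑ k, β k • ψ k) x) ^ 2)
        ∂(S.law ν P (j - 1)) := by
    rw [lintegral_map_stratumPoint hψ hhm (y, z) _ ρ
      (F := fun w => ENNReal.ofReal ((w.2 - β ⬝ᵥ w.1) ^ 2))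
      ((measurable_snd.sub (hdot _)).pow_const 2).ennreal_ofReal (by simp)]
    simp [dotProduct]
  simp only [e1] at main
  rw [lintegral_const_mul' _ _ hpt', e2] at main
  -- Both integrals in `main` carry the factor `ρ {(y, z)} = prob y`; cancelling it leaves `1 / prob
  -- y` on the `K` term alone.
  rw [← ENNReal.mul_le_mul_iff_right hp0 hpt', mul_add]
  refine main.trans_eq ?_
  rw [mul_left_comm]
  congr 1
  rw [hp, ← ENNReal.ofReal_mul (prob_pos y).le]
  congr 1
  have := prob_pos y
  field_simp

lemma lintegral_stratum_le_of_wellApproximated (hν : ν.IsOrderTwo S.J P)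
    (hτ : IsTraining τ S.J P) (hK : 1 ≤ K)
    {ψ : Fin K → (Fin d → ℝ) → ℝ} (hψ : ∀ k, Measurable (ψ k)) {A : ℝ}
    (hA : S.Bounded ν P A) {C κ : ℝ} (hC : 0 < C) (happ : S.WellApproximated ν P ψ C κ)
    (hj : j ∈ Finset.Icc 1 S.J)
    {y : Fin m → ℝ} (hy : y ∈ valuesXi m) {z : Pairs m → ℝ} (hz : z ∈ valuesV m)
    {b : Ω → Fin K → ℝ}
    (hb : ∀ᵐ ω ∂P, ∀ β : Fin K → ℝ,
      S.residual ν P ψ τ j y z ω (b ω) ≤ S.residual ν P ψ τ j y z ω β) :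
    ∫⁻ ω, ∫⁻ x, ENNReal.ofReal ((truncate A (linComb ψ (b ω) x) - S.h ν P j y z x) ^ 2)
        ∂(S.law ν P (j - 1)) ∂P ≤
      ENNReal.ofReal (8 * C / (K : ℝ) ^ κ + 8 * A ^ 2 * K / ((N + 1) * prob y)) := by
  have hp := prob_pos y
  have hKpos : (0 : ℝ) < K := by exact_mod_cast hK
  have hε : 0 < C / (K : ℝ) ^ κ := div_pos hC (Real.rpow_pos_of_pos hKpos κ)
  -- The infimum over the span is not assumed attained; a competitor within a factor `2` turns the
  -- `4` of the risk bound into `8`.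
  have hlt : ENNReal.ofReal (C / (K : ℝ) ^ κ) < ENNReal.ofReal (2 * (C / (K : ℝ) ^ κ)) :=
    (ENNReal.ofReal_lt_ofReal_iff (by positivity)).mpr (by linarith)
  obtain ⟨g, hg⟩ := iInf_lt_iff.mp ((happ j hj y hy z hz).trans_lt hlt)
  obtain ⟨hgs, hg⟩ := iInf_lt_iff.mp hg
  refine (lintegral_stratum_le S hν hτ hψ hA hj hy hz hb hgs).trans ?_
  rw [ENNReal.ofReal_add (by positivity) (by positivity)]
  gcongr
  calc _ ≤ 4 * ENNReal.ofReal (2 * (C / (K : ℝ) ^ κ)) := by gcongr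
    _ = _ := by
      rw [← ENNReal.ofReal_ofNat, ← ENNReal.ofReal_mul (by norm_num)]
      congr 1; ring

end Strata

/-! ### Weights of the strata -/

section WeightedSum

variable {m : ℕ}

lemma card_values (m : ℕ) : ((valuesXi m ×ˢ valuesV m).card : ℝ) = cConst m := by
  rw [Finset.card_product, card_valuesXi, card_valuesV, cConst]; push_cast; rfl

lemma cConst_pos (m : ℕ) : 0 < cConst m := by unfold cConst; positivity

/-- Summation of the errors of the strata, weighted by the squared coefficients. -/
lemma sum_weight_mul_error (o : Fin m → Fin 3) (r : Pairs m → Fin 2) (a b : ℝ) :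
    ∑ t ∈ valuesXi m ×ˢ valuesV m,
        cConst m * (prob t.1 * hermiteProd o t.1 * signProd r t.2) ^ 2 * (a + b / prob t.1) =
      a * cConstO o + cConst m * b := by
  have h1 : ∀ t ∈ valuesXi m ×ˢ valuesV m,
      cConst m * (prob t.1 * hermiteProd o t.1 * signProd r t.2) ^ 2 * (a + b / prob t.1) =
        a * (cConst m * (prob t.1 * hermiteProd o t.1) ^ 2) +
          cConst m * b * (prob t.1 * hermiteProd o t.1 ^ 2) := by
    intro t ht
    have := (prob_pos t.1).ne'
    rw [mul_pow, sq_signProd r (Finset.mem_product.mp ht).2]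
    field_simp
  rw [Finset.sum_congr rfl h1, Finset.sum_add_distrib, ← Finset.mul_sum, ← Finset.mul_sum,
    ← Finset.mul_sum, Finset.sum_product (f := fun t : _ × _ => prob t.1 * hermiteProd o t.1 ^ 2),
    sum_prob_mul_sq_hermiteProd, mul_one, Finset.sum_product, cConstO]
  rw [Finset.mul_sum]
  congr 2
  refine Finset.sum_congr rfl fun y _ => ?_
  dsimp only
  rw [Finset.sum_const, card_valuesV, nsmul_eq_mul]
  push_cast
  ring

end WeightedSum

end SRCV

/-! ### Assembly of the stratum errors -/

theorem lemma2 :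
    ∃ c : ℝ, 0 < c ∧
      ∀ (Ω : Type*) [MeasurableSpace Ω] (P : Measure Ω) [IsProbabilityMeasure P]
        (d m : ℕ) (S : SRCV.Scheme d m)
        (ν : SRCV.Noise Ω m) (_ : ν.IsOrderTwo S.J P)
        (N : ℕ) (_ : 1 ≤ N) (τ : Fin N → SRCV.Noise Ω m) (_ : SRCV.IsTraining τ S.J P)
        (K : ℕ) (_ : 1 ≤ K) (ψ : Fin K → (Fin d → ℝ) → ℝ) (_ : ∀ k, Measurable (ψ k))
        (A : ℝ) (_ : 0 < A) (_ : S.Bounded ν P A)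
        (κ C : ℝ) (_ : 0 < κ) (_ : 0 < C) (_ : S.WellApproximated ν P ψ C κ)
        (α : ℕ → (Fin m → ℝ) → (SRCV.Pairs m → ℝ) → Ω → Fin K → ℝ)
        (_ : S.IsRegression ν P ψ τ α),
        ∀ j ∈ Finset.Icc 1 S.J, ∀ (o : Fin m → Fin 3) (r : SRCV.Pairs m → Fin 2),
          (o, r) ∈ SRCV.indexU m →
          ∫⁻ ω, ∫⁻ x, ENNReal.ofReal
              ((SRCV.aEstimate A ψ α j o r ω x - S.a ν P j o r x) ^ 2)
              ∂(S.law ν P (j - 1)) ∂P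
            ≤ ENNReal.ofReal
              (SRCV.cConst m * c * A ^ 2 * (Real.log N + 1) * (K / N)
                + 8 * C / (K : ℝ) ^ κ * SRCV.cConstO o) := by
  -- At most `2 K` points of high leverage, each costing `4 A²`.
  refine ⟨8, by norm_num, ?_⟩
  intro Ω _ P _ d m S ν hν N hN τ hτ K hK ψ hψ A _ hbdd κ C _ hC happ α hα j hj o r _
  have hj' := Finset.mem_Icc.mp hj
  have hlawp : IsProbabilityMeasure (S.law ν P (j - 1)) :=
    Measure.isProbabilityMeasure_map (S.measurable_path_of_isOrderTwo hν (by omega)).aemeasurable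
  let T := SRCV.valuesXi m ×ˢ SRCV.valuesV m
  let w : (Fin m → ℝ) × (SRCV.Pairs m → ℝ) → ℝ := fun t =>
    SRCV.prob t.1 * SRCV.hermiteProd o t.1 * SRCV.signProd r t.2
  let e : (Fin m → ℝ) × (SRCV.Pairs m → ℝ) → Ω → (Fin d → ℝ) → ℝ := fun t ω x =>
    SRCV.truncate A (SRCV.linComb ψ (α j t.1 t.2 ω) x) - S.h ν P j t.1 t.2 x
  have hc := SRCV.cConst_pos m
  -- Joint measurability, hence that of the coefficients, serves to exchange the sum over strata
  -- with the integrals.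
  have hem : ∀ t ∈ T, Measurable fun q : Ω × (Fin d → ℝ) => ENNReal.ofReal (e t q.1 q.2 ^ 2) := by
    intro t ht
    obtain ⟨h1, h2⟩ := Finset.mem_product.mp ht
    have hαm := (hα j hj t.1 h1 t.2 h2).1
    refine (Measurable.pow_const (Measurable.sub ((SRCV.measurable_truncate A).comp ?_)
      ((S.measurable_h hν hj'.2 t.1 t.2).comp measurable_snd)) 2).ennreal_ofReal
    exact Finset.measurable_sum _ fun k _ =>
      (((measurable_pi_apply k).comp hαm).comp measurable_fst).mul ((hψ k).comp measurable_snd)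
  have hpoint : ∀ ω x, ENNReal.ofReal
      ((SRCV.aEstimate A ψ α j o r ω x - S.a ν P j o r x) ^ 2) ≤
      ∑ t ∈ T, ENNReal.ofReal (SRCV.cConst m * w t ^ 2) * ENNReal.ofReal (e t ω x ^ 2) := by
    intro ω x
    have hdiff : SRCV.aEstimate A ψ α j o r ω x - S.a ν P j o r x = ∑ t ∈ T, w t * e t ω x := by
      rw [S.a_eq_sum hν hj, SRCV.aEstimate, Finset.sum_product]
      simp only [← Finset.sum_sub_distrib, w, e, mul_sub]
    -- Cauchy–Schwarz; the number of strata is `c_m`.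
    have hcs := sq_sum_le_card_mul_sum_sq (s := T) (f := fun t => w t * e t ω x)
    rw [SRCV.card_values] at hcs
    rw [hdiff, Finset.sum_congr rfl fun t _ =>
      (ENNReal.ofReal_mul (q := e t ω x ^ 2) (by positivity : 0 ≤ SRCV.cConst m * w t ^ 2)).symm,
      ← ENNReal.ofReal_sum_of_nonneg fun t _ => by positivity]
    refine ENNReal.ofReal_le_ofReal (hcs.trans_eq ?_)
    rw [Finset.mul_sum]
    exact Finset.sum_congr rfl fun t _ => by ring
  have hNpos : (0 : ℝ) < N := by exact_mod_cast hN
  have hlog : 0 ≤ Real.log N := Real.log_nonneg (by exact_mod_cast hN)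
  calc _ ≤ ∫⁻ ω, ∫⁻ x, ∑ t ∈ T, ENNReal.ofReal (SRCV.cConst m * w t ^ 2) *
          ENNReal.ofReal (e t ω x ^ 2) ∂(S.law ν P (j - 1)) ∂P :=
        lintegral_mono fun ω => lintegral_mono fun x => hpoint ω x
    _ = ∑ t ∈ T, ENNReal.ofReal (SRCV.cConst m * w t ^ 2) *
          ∫⁻ ω, ∫⁻ x, ENNReal.ofReal (e t ω x ^ 2) ∂(S.law ν P (j - 1)) ∂P := by
        have h1 : ∀ ω, ∫⁻ x, ∑ t ∈ T, ENNReal.ofReal (SRCV.cConst m * w t ^ 2) *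
            ENNReal.ofReal (e t ω x ^ 2) ∂(S.law ν P (j - 1)) =
            ∑ t ∈ T, ENNReal.ofReal (SRCV.cConst m * w t ^ 2) *
              ∫⁻ x, ENNReal.ofReal (e t ω x ^ 2) ∂(S.law ν P (j - 1)) := by
          intro ω
          rw [lintegral_finsetSum]
          · exact Finset.sum_congr rfl fun t _ =>
              lintegral_const_mul' _ _ ENNReal.ofReal_ne_top
          · exact fun t ht => ((hem t ht).comp measurable_prodMk_left).const_mul _
        simp only [h1]
        rw [lintegral_finsetSum]
        · exact Finset.sum_congr rfl fun t _ =>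
            lintegral_const_mul' _ _ ENNReal.ofReal_ne_top
        · exact fun t ht => (hem t ht).lintegral_prod_right'.const_mul _
    _ ≤ ∑ t ∈ T, ENNReal.ofReal (SRCV.cConst m * w t ^ 2) *
          ENNReal.ofReal (8 * C / (K : ℝ) ^ κ + 8 * A ^ 2 * K / ((N + 1) * SRCV.prob t.1)) := by
        refine Finset.sum_le_sum fun t ht => ?_
        obtain ⟨h1, h2⟩ := Finset.mem_product.mp ht
        gcongr
        exact SRCV.lintegral_stratum_le_of_wellApproximated S hν hτ hK hψ hbdd hC happ hj h1 h2
          (hα j hj t.1 h1 t.2 h2).2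
    _ = ENNReal.ofReal (8 * C / (K : ℝ) ^ κ * SRCV.cConstO o +
          SRCV.cConst m * (8 * A ^ 2 * K / (N + 1))) := by
        rw [← SRCV.sum_weight_mul_error o r, ENNReal.ofReal_sum_of_nonneg]
        · refine Finset.sum_congr rfl fun t _ => ?_
          rw [← ENNReal.ofReal_mul (by positivity), div_div]
        · intro t _
          have := SRCV.prob_pos t.1
          positivity
    _ ≤ _ := by
        refine ENNReal.ofReal_le_ofReal ?_
        rw [add_comm]
        refine add_le_add_left ?_ _
        -- The bound obtained so far has no logarithm; the stated one follows because `log N ≥ 0`.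
        have h1 : (K : ℝ) / (N + 1) ≤ (Real.log N + 1) * (K / N) := by
          have h2 : (K : ℝ) / (N + 1) ≤ K / N := by gcongr; linarith
          have h3 : 0 ≤ (K : ℝ) / N := by positivity
          nlinarith
        calc SRCV.cConst m * (8 * A ^ 2 * K / (N + 1)) =
              SRCV.cConst m * 8 * A ^ 2 * (K / (N + 1)) := by ring
          _ ≤ SRCV.cConst m * 8 * A ^ 2 * ((Real.log N + 1) * (K / N)) := by gcongr
          _ = _ := by ring
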